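/- \textbf{Definitions.} Let $G$ be a group with a finite generating set $S_G$. For real $p\ge 1$ and $x\in\mathbb{R}$, the $\ell^p$-isoperimetric profile of $G$ is $$j_{p,G}(x)=\sup\left\{\frac{\|f\|_p}{\|\nabla f\|_p}\;:\; f\colon G\to[0,\infty),\ f\neq 0,\ |\operatorname{supp} f|\le x\right\},\qquad \|\nabla f\|_p^p=\sum_{g\in G,\,s\in S_G}|f(g)-f(gs)|^p,$$ (the supremum of the empty set being $0$), and $j_G=j_{1,G}$. A \emph{halo of groups} over a group $H$ consists of a group $L(H)$ and subgroups $L(S)\le L(H)$, $S\subseteq H$ (with $L(S)$ for $S=H$ being the whole group), such that $L(R)\le L(S)$ if $R\subseteq S$, $L(\emptyset)=\{1\}$, $L(H)$ is generated by the $L(S)$ with $S$ finite, and $L(R\cap S)=L(R)\cap L(S)$. Given moreover a morphism $\alpha\colon H\to\operatorname{Aut}(L(H))$ with $\alpha(h)(L(S))=L(hS)$ for all $h\in H$ and $S\subseteq H$, the \emph{halo product} is $\mathscr{L}H=L(H)\rtimes_\alpha H$. It is \begin{itemize} \item \emph{naturally generated} if, for some finite generating set $S_H$ of $H$, it is generated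 by the elements $(1,s)$ and $(\sigma,1)$ with $s\in S_H$, $\sigma\in L(\{1,s\})$; \item \emph{large-scale commutative} if, for some (equivalently, any) finite generating set $S_H$ of $H$, there is $D\ge0$ such that $L(R)$ and $L(S)$ commute whenever $d_{S_H}(R,S)\ge D$; \item with \emph{consistent blocks} if, for $S\subseteq H$ finite, $L(S)$ is finite and $|L(S)|$ depends only on $|S|$; its \emph{lamp growth sequence} is then $\Lambda_{\mathscr{L}H}(m)=|L(S)|$ for $|S|=m$. \end{itemize} Let $\mathscr{L}$ be a rule which assigns to every group $K$ the data of a halo product $\mathscr{L}K$ over $K$, and put $\mathscr{L}^{\circ 0}H=H$, $\mathscr{L}^{\circ(k+1)}H=\mathscr{L}(\mathscr{L}^{\circ k}H)$. \textbf{Statement.} Let $H$ be an infinite finitely generated amenable group such that the lamp group $L(H)$ of $\mathscr{L}H$ is nontrivial, let $p\ge1$ be real and let $n\ge0$ be an integer. Assume that for every $0\le k<n$ the halo product $\mathscr{L}(\mathscr{L}^{\circ k}H)$ is naturally generated, large-scale commutative, has consistent blocks, and has the same lamp growth sequence $\Lambda=\Lambda_{\mathscr{L}H}$. Let $\varphi(x)=x\cdot\Lambda(\lfloor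 x\rfloor)$ for real $x\ge0$, let $\varphi^{-1}(y)=\sup\{x\ge0:\varphi(x)\le y\}$ be its generalised inverse, and for $C>0$ let $\Psi_C(x)=\frac1C\varphi^{-1}(x)$. Then, for any finite generating sets of $H$ and of $\mathscr{L}^{\circ n}H$ used to define the profiles, there is a constant $C>0$ such that, for all sufficiently large real $x$, $$\frac1C\,j_{p,H}\left(\Psi_C^{\circ n}(x)\right)\ \le\ j_{p,\mathscr{L}^{\circ n}H}(x)\ \le\ C\,j_{H}\left(C\ln^{\circ n}x\right).$$ -/

import Mathlib

open Filter
open scoped ENNReal Pointwise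

universe u

/-! ### Isoperimetric profiles -/

/-- A discrete group is amenable if it carries a left-invariant finitely additive
probability measure defined on all subsets. -/
def AmenableGroup (G : Type u) [Group G] : Prop :=
  ∃ m : Set G → ℝ≥0∞, m Set.univ = 1 ∧
    (∀ A B : Set G, Disjoint A B → m (A ∪ B) = m A + m B) ∧
    ∀ (g : G) (A : Set G), m (g • A) = m A

/-- `S` is a (finite) generating set of the group `G`. -/
def IsGeneratingSet {G : Type u} [Group G] (S : Finset G) : Prop :=
  Subgroup.closure (S : Set G) = ⊤

/-- The norm `‖f‖_p = (∑_g |f g|^p)^(1/p)`. -/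
noncomputable def pNorm {G : Type u} (p : ℝ) (f : G → ℝ) : ℝ≥0∞ :=
  (∑' g, ‖f g‖ₑ ^ p) ^ (1 / p)

/-- The norm of the gradient `‖∇f‖_p = (∑_{g, s} |f g - f (g s)|^p)^(1/p)`, where `s` ranges
over the finite set `S`. -/
noncomputable def gradNorm {G : Type u} [Group G] (S : Finset G) (p : ℝ) (f : G → ℝ) : ℝ≥0∞ :=
  (∑' g, ∑ s ∈ S, ‖f g - f (g * s)‖ₑ ^ p) ^ (1 / p)

/-- The `ℓ^p`-isoperimetric profile of `G` with respect to `S`: the supremum of `‖f‖_p / ‖∇f‖_p`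
over all finitely supported `f : G → [0, ∞)` with `|supp f| ≤ x`. The values are taken in `[0, ∞]`,
so that the supremum is never a junk value; `0 / 0 = 0` there, so `f = 0` does not contribute. -/
noncomputable def isoProfile {G : Type u} [Group G] (S : Finset G) (p x : ℝ) : ℝ≥0∞ :=
  ⨆ (f : G → ℝ) (_ : ∀ g, 0 ≤ f g) (_ : (Function.support f).Finite)
    (_ : ((Function.support f).ncard : ℝ) ≤ x), pNorm p f / gradNorm S p f

/-- Word length with respect to `S`. -/
noncomputable def wordLength {G : Type u} [Group G] (S : Finset G) (g : G) : ℕ :=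
  sInf {n : ℕ | ∃ l : List G, (∀ a ∈ l, a ∈ S ∨ a⁻¹ ∈ S) ∧ l.prod = g ∧ l.length = n}

/-- The left-invariant word metric with respect to `S`. -/
noncomputable def wordDist {G : Type u} [Group G] (S : Finset G) (g h : G) : ℕ :=
  wordLength S (g⁻¹ * h)

/-! ### Halos and halo products -/

/-- A halo of groups over a set `X`; `Lamp` is the group `L(X)`, and the groups `L(S)` are given as
subgroups of it. -/
structure HaloOfGroups (X : Type u) where
  Lamp : Type u
  [group : Group Lamp]
  L : Set X → Subgroup Lamp
  mono : ∀ R S : Set X, R ⊆ S → L R ≤ L S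
  empty : L ∅ = ⊥
  univ : L Set.univ = ⊤
  iSup_finite : ⨆ S : Finset X, L (S : Set X) = ⊤
  inter : ∀ R S : Set X, L (R ∩ S) = L R ⊓ L S

attribute [instance] HaloOfGroups.group

/-- A halo over a group `H` together with an action `α` of `H` on `L(H)` compatible with left
multiplication: the data defining a halo product over `H`. -/
structure EquivariantHalo (H : Type u) [Group H] extends HaloOfGroups H where
  α : H →* MulAut Lamp
  map_α : ∀ (h : H) (S : Set H), (L S).map (α h).toMonoidHom = L (h • S)

namespace EquivariantHalo

variable {H : Type u} [Group H] (𝓛 : EquivariantHalo H)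

/-- The halo product `L(H) ⋊ H`. -/
abbrev Product : Type u := 𝓛.Lamp ⋊[𝓛.α] H

/-- Large-scale commutativity: `L(R)` and `L(S)` commute as soon as `R` and `S` are at distance at
least `D`, for some constant `D`. -/
def LargeScaleCommutative : Prop :=
  ∃ T : Finset H, IsGeneratingSet T ∧ ∃ D : ℕ, ∀ R S : Set H,
    (∀ r ∈ R, ∀ s ∈ S, D ≤ wordDist T r s) →
      ∀ a ∈ 𝓛.L R, ∀ b ∈ 𝓛.L S, a * b = b * a

/-- Natural generation: for some finite generating set `T` of `H`, the halo product is generated by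
the `(1, s)` and the `(σ, 1)` with `s ∈ T` and `σ ∈ L({1, s})`. -/
def NaturallyGenerated : Prop :=
  ∃ T : Finset H, IsGeneratingSet T ∧
    Subgroup.closure
      ({x : 𝓛.Product | ∃ s ∈ T, x = SemidirectProduct.inr s} ∪
        {x : 𝓛.Product | ∃ s ∈ T, ∃ σ ∈ 𝓛.L {1, s}, x = SemidirectProduct.inl σ}) = ⊤

/-- Consistent blocks: `L(S)` is finite for finite `S`, with cardinality depending only on `|S|`. -/
def ConsistentBlocks : Prop :=
  (∀ S : Finset H, Finite (𝓛.L (S : Set H))) ∧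
    ∀ R S : Finset H, R.card = S.card →
      Nat.card (𝓛.L (R : Set H)) = Nat.card (𝓛.L (S : Set H))

open Classical in
/-- The lamp growth sequence `n ↦ |L(S)|`, where `|S| = n` (and `0` if there is no such `S`). -/
noncomputable def lampGrowth (n : ℕ) : ℕ :=
  if h : ∃ S : Finset H, S.card = n then Nat.card (𝓛.L (h.choose : Set H)) else 0

end EquivariantHalo

/-- The iterated halo products `𝓛^{∘0} H = H`, `𝓛^{∘(n+1)} H = 𝓛 (𝓛^{∘n} H)`, where `𝓛` is a rule
that assigns to a group `K` the data defining a halo product over `K`. -/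
def iteratedHaloProduct (𝓛 : ∀ (K : Type u) [Group K], EquivariantHalo K)
    (H : Type u) [Group H] : ℕ → GrpCat.{u}
  | 0 => GrpCat.of H
  | n + 1 => GrpCat.of (𝓛 (iteratedHaloProduct 𝓛 H n)).Product

/-! ### The comparison functions -/

/-- The function `φ(x) = x · Λ(x)`, with a sequence `Λ` extended to real arguments by
`Λ(x) = Λ(⌊x⌋)`. -/
noncomputable def phi (Λ : ℕ → ℕ) (x : ℝ) : ℝ := x * Λ ⌊x⌋₊

/-- The (generalised) inverse of `φ` on `[0, ∞)`. -/
noncomputable def phiInv (Λ : ℕ → ℕ) (y : ℝ) : ℝ := sSup {x : ℝ | 0 ≤ x ∧ phi Λ x ≤ y}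

/-- The function `Ψ_C(x) = φ⁻¹(x) / C`. -/
noncomputable def psi (Λ : ℕ → ℕ) (C x : ℝ) : ℝ := 1 / C * phiInv Λ x

/-! Lower bound. Let `f` be supported on a finite subset `F` of the base `K`, and let `T` be the
finite generating set of `K` from natural generation. Spread `f` over the halo product as `(σ, h) ↦
f h` for `σ ∈ L(F ∪ FT)`, and `0` for other `σ`. At a position `h ∈ F`, a generator `τ ∈ L({1, s})`
modifies lamps only within `L({h, hs})`, so it does not change the new function, while the moves in
`T` reproduce the gradient of `f`. The ratio of norms is not decreased, and the support has `|F|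
Λ(|F ∪ FT|) ≤ φ((1 + |T|)|F|)` points (`isoProfile_le_isoProfile_product`).

Upper bound. Passing from `f` to `f ^ p` dominates the `ℓ^p`-profile by the `ℓ^1`-profile, and the
coarea argument reduces the latter to finite sets `A`. Fix a nontrivial lamp `τ` in some `L(P)` with
`P` finite, and cut `A` into slices of constant lamp configuration. If slices of fewer than `m`
points fill a fixed proportion of `A`, isoperimetry of `K` applies to them; if `τ` moves a fixed
proportion out of `A`, the boundary is large. Otherwise the set `W` of configurations with a slice
of at least `m` points spans at least about `m |W|` edges in the directions `α h τ`. These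
directions are almost independent, as in a hypercube, so an entropy-type inequality
(`sum_card_edges_le`) allows only `O(|W| log |W|)` edges, whence `m = O(log |A|)`. Taking `m` to be
a large multiple of `log x` excludes this case (`card_le_mul_gradEnergy`).

Both bounds are iterated along the tower; the constants are absorbed because `psi` decreases in `C`
and `log (C x) ≤ C log x` for large `x`. -/

/-- The `p`-th power of the norm of the gradient. -/
noncomputable def gradEnergy {G : Type u} [Group G] (S : Finset G) (p : ℝ) (f : G → ℝ) : ℝ≥0∞ :=
  ∑' g, ∑ s ∈ S, ‖f g - f (g * s)‖ₑ ^ p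

/-! ### Comparison of gradients along different finite sets -/

section ChangeOfGenerators

variable {G : Type u} [Group G]

lemma le_isoProfile {S : Finset G} {p x : ℝ} {f : G → ℝ} (hf : ∀ g, 0 ≤ f g)
    (hfin : (Function.support f).Finite) (hcard : ((Function.support f).ncard : ℝ) ≤ x) :
    pNorm p f / gradNorm S p f ≤ isoProfile S p x := by
  unfold isoProfile
  exact le_iSup_of_le f (le_iSup_of_le hf (le_iSup_of_le hfin (le_iSup_of_le hcard le_rfl)))

lemma isoProfile_le {S : Finset G} {p x : ℝ} {b : ℝ≥0∞}
    (h : ∀ f : G → ℝ, (∀ g, 0 ≤ f g) → (Function.support f).Finite →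
      ((Function.support f).ncard : ℝ) ≤ x → pNorm p f / gradNorm S p f ≤ b) :
    isoProfile S p x ≤ b := by
  unfold isoProfile
  exact iSup_le fun f => iSup_le fun h1 => iSup_le fun h2 => iSup_le fun h3 => h f h1 h2 h3

lemma isoProfile_mono {S : Finset G} {p x y : ℝ} (h : x ≤ y) :
    isoProfile S p x ≤ isoProfile S p y :=
  isoProfile_le fun _ h1 h2 h3 => le_isoProfile h1 h2 (h3.trans h)

lemma ENNReal.div_le_mul_div {a b c C : ℝ≥0∞} (hC : C ≠ ⊤) (hC0 : C ≠ 0) (h : c ≤ C * b) :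
    a / b ≤ C * (a / c) := by
  rw [← ENNReal.mul_div_mul_left a b hC0 hC, ← mul_div_assoc]
  exact ENNReal.div_le_div_left h _

/-- Every right translate is controlled by the gradient along a generating set. -/
lemma exists_translate_le_gradEnergy {S : Finset G} (hS : IsGeneratingSet S) {p : ℝ} (hp : 1 ≤ p)
    (a : G) : ∃ C : ℝ≥0∞, C ≠ ⊤ ∧ ∀ f : G → ℝ,
      ∑' g, ‖f g - f (g * a)‖ₑ ^ p ≤ C * gradEnergy S p f := by
  have ha : a ∈ Subgroup.closure (S : Set G) := by rw [hS]; trivial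
  have hp0 : 0 < p := by linarith
  induction ha using Subgroup.closure_induction with
  | mem s hs =>
    refine ⟨1, by simp, fun f => ?_⟩
    rw [one_mul]
    refine ENNReal.tsum_le_tsum fun g => ?_
    exact Finset.single_le_sum (f := fun s => ‖f g - f (g * s)‖ₑ ^ p) (fun _ _ => zero_le) hs
  | one => exact ⟨0, by simp, fun f => by simp [hp0]⟩
  | mul a b _ _ iha ihb =>
    obtain ⟨A, hA, hA'⟩ := iha
    obtain ⟨B, hB, hB'⟩ := ihb
    refine ⟨2 ^ (p - 1) * (A + B), ?_, fun f => ?_⟩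
    · exact ENNReal.mul_ne_top (ENNReal.rpow_ne_top_of_nonneg (by linarith) (by simp))
        (ENNReal.add_ne_top.2 ⟨hA, hB⟩)
    have e : ∑' g, ‖f (g * a) - f (g * a * b)‖ₑ ^ p = ∑' g, ‖f g - f (g * b)‖ₑ ^ p :=
      (Equiv.mulRight a).tsum_eq fun g => ‖f g - f (g * b)‖ₑ ^ p
    calc ∑' g, ‖f g - f (g * (a * b))‖ₑ ^ p
        ≤ ∑' g, 2 ^ (p - 1) * (‖f g - f (g * a)‖ₑ ^ p + ‖f (g * a) - f (g * a * b)‖ₑ ^ p) := by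
          refine ENNReal.tsum_le_tsum fun g => ?_
          refine le_trans ?_ (ENNReal.rpow_add_le_mul_rpow_add_rpow _ _ hp)
          refine ENNReal.rpow_le_rpow ?_ hp0.le
          rw [← mul_assoc, ← sub_add_sub_cancel (f g) (f (g * a)) (f (g * a * b))]
          exact enorm_add_le _ _
      _ = 2 ^ (p - 1) * (∑' g, ‖f g - f (g * a)‖ₑ ^ p + ∑' g, ‖f g - f (g * b)‖ₑ ^ p) := by
          rw [ENNReal.tsum_mul_left, ENNReal.tsum_add, e]
      _ ≤ 2 ^ (p - 1) * (A * gradEnergy S p f + B * gradEnergy S p f) := by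
          gcongr
          · exact hA' f
          · exact hB' f
      _ = _ := by ring
  | inv a _ iha =>
    obtain ⟨A, hA, hA'⟩ := iha
    refine ⟨A, hA, fun f => le_trans (le_of_eq ?_) (hA' f)⟩
    rw [← (Equiv.mulRight a).tsum_eq fun g => ‖f g - f (g * a⁻¹)‖ₑ ^ p]
    refine tsum_congr fun g => ?_
    simp only [Equiv.coe_mulRight, mul_inv_cancel_right]
    rw [← enorm_neg, neg_sub]

lemma exists_gradEnergy_le {S : Finset G} (hS : IsGeneratingSet S) (T : Finset G) {p : ℝ}
    (hp : 1 ≤ p) : ∃ C : ℝ≥0∞, C ≠ ⊤ ∧ ∀ f : G → ℝ, gradEnergy T p f ≤ C * gradEnergy S p f := by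
  choose C hC hC' using exists_translate_le_gradEnergy hS hp
  refine ⟨∑ t ∈ T, C t, ENNReal.sum_ne_top.2 fun t _ => hC t, fun f => ?_⟩
  rw [gradEnergy, Summable.tsum_finsetSum fun _ _ => ENNReal.summable, Finset.sum_mul]
  exact Finset.sum_le_sum fun t _ => hC' t f

/-- The profile with respect to a generating set is dominated by the profile with respect to any
finite set. -/
lemma exists_isoProfile_le {S : Finset G} (hS : IsGeneratingSet S) (T : Finset G) {p : ℝ}
    (hp : 1 ≤ p) : ∃ C : ℝ, 1 ≤ C ∧ ∀ x : ℝ,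
      isoProfile S p x ≤ ENNReal.ofReal C * isoProfile T p x := by
  obtain ⟨A, hA, hA'⟩ := exists_gradEnergy_le hS T hp
  have hp0 : 0 < p := by linarith
  have hB : A ^ (1 / p) ≠ ⊤ := ENNReal.rpow_ne_top_of_nonneg (by positivity) hA
  set C : ℝ := max 1 (A ^ (1 / p)).toReal
  have hC : A ^ (1 / p) ≤ ENNReal.ofReal C := by
    rw [← ENNReal.ofReal_toReal hB]
    exact ENNReal.ofReal_le_ofReal (le_max_right _ _)
  have hC1 : (1 : ℝ) ≤ C := le_max_left _ _
  refine ⟨C, hC1, fun x => isoProfile_le fun f h1 h2 h3 => ?_⟩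
  refine (ENNReal.div_le_mul_div ENNReal.ofReal_ne_top (C := ENNReal.ofReal C) ?_ ?_).trans
    (mul_le_mul_right (le_isoProfile h1 h2 h3) _)
  · simp; linarith
  · calc gradNorm T p f = gradEnergy T p f ^ (1 / p) := rfl
      _ ≤ (A * gradEnergy S p f) ^ (1 / p) := ENNReal.rpow_le_rpow (hA' f) (by positivity)
      _ = A ^ (1 / p) * gradNorm S p f := by
          rw [ENNReal.mul_rpow_of_nonneg _ _ (by positivity)]; rfl
      _ ≤ _ := by gcongr

end ChangeOfGenerators

/-! ### From `ℓ^p` to `ℓ^1` -/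

section Exponents

/-- Bernoulli's inequality at `b / a - 1`, multiplied by `a ^ p`. -/
lemma Real.rpow_sub_rpow_le_mul {a b p : ℝ} (hb : 0 ≤ b) (hab : b ≤ a) (hp : 1 ≤ p) :
    a ^ p - b ^ p ≤ p * ((a - b) * a ^ (p - 1)) := by
  rcases (hb.trans hab).eq_or_lt with h0 | ha
  · have : b = 0 := le_antisymm (h0 ▸ hab) hb
    subst this; subst h0; simp
  have h1 := one_add_mul_self_le_rpow_one_add (s := b / a - 1)
    (by linarith [div_nonneg hb ha.le]) hp
  rw [add_sub_cancel, Real.div_rpow hb ha.le, le_div_iff₀ (Real.rpow_pos_of_pos ha p)] at h1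
  have h2 : a ^ p = a * a ^ (p - 1) := by
    rw [Real.rpow_sub ha, Real.rpow_one]; field_simp
  have h3 : (1 + p * (b / a - 1)) * (a * a ^ (p - 1)) =
      a * a ^ (p - 1) - p * ((a - b) * a ^ (p - 1)) := by
    field_simp; ring
  rw [h2, h3] at h1
  rw [h2]; linarith

/-- A weighted Young inequality without optimal constants. -/
lemma Real.mul_rpow_sub_one_le {u v t p : ℝ} (hu : 0 ≤ u) (hv : 0 ≤ v) (ht : 0 < t)
    (hp : 1 ≤ p) : u * v ^ (p - 1) ≤ t ^ (p - 1) * u ^ p + v ^ p / t := by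
  have split : ∀ w : ℝ, 0 ≤ w → w ^ p = w ^ (p - 1) * w := fun w hw => by
    have := Real.rpow_add_one' hw (y := p - 1) (by linarith)
    rwa [sub_add_cancel] at this
  -- According to whether `v ≤ t * u`, one of the two terms on the right suffices alone.
  rcases le_total v (t * u) with h | h
  · have : v ^ (p - 1) ≤ t ^ (p - 1) * u ^ (p - 1) := by
      rw [← Real.mul_rpow ht.le hu]; exact Real.rpow_le_rpow hv h (by linarith)
    have h2 : 0 ≤ v ^ p / t := by positivity
    rw [split u hu]
    nlinarith [mul_le_mul_of_nonneg_left this hu]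
  · have : u ≤ v / t := by rw [le_div_iff₀ ht]; linarith
    have h2 : 0 ≤ t ^ (p - 1) * u ^ p := by positivity
    rw [split v hv]
    have h3 := mul_le_mul_of_nonneg_right this (Real.rpow_nonneg hv (p - 1))
    have h4 : v / t * v ^ (p - 1) = v ^ (p - 1) * v / t := by ring
    linarith

lemma Real.abs_rpow_sub_rpow_le {a b t p : ℝ} (ha : 0 ≤ a) (hb : 0 ≤ b) (ht : 0 < t)
    (hp : 1 ≤ p) :
    |a ^ p - b ^ p| ≤ p * (t ^ (p - 1) * |a - b| ^ p + (a ^ p + b ^ p) / t) := by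
  wlog h : b ≤ a generalizing a b
  · have := this hb ha (le_of_not_ge h)
    rwa [abs_sub_comm, abs_sub_comm b a, add_comm (b ^ p)] at this
  rw [abs_of_nonneg (sub_nonneg.2 (Real.rpow_le_rpow hb h (by linarith))),
    abs_of_nonneg (sub_nonneg.2 h)]
  refine (Real.rpow_sub_rpow_le_mul hb h hp).trans ?_
  refine mul_le_mul_of_nonneg_left ?_ (by linarith)
  refine (Real.mul_rpow_sub_one_le (sub_nonneg.2 h) ha ht hp).trans ?_
  have : 0 ≤ b ^ p := by positivity
  gcongr
  linarith

lemma enorm_rpow_of_nonneg {a p : ℝ} (ha : 0 ≤ a) (hp : 0 ≤ p) : ‖a‖ₑ ^ p = ‖a ^ p‖ₑ := by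
  rw [Real.enorm_eq_ofReal ha, Real.enorm_eq_ofReal (by positivity),
    ENNReal.ofReal_rpow_of_nonneg ha hp]

lemma tsum_enorm_rpow_ne_top {X : Type u} {p : ℝ} (hp : 0 < p) {f : X → ℝ}
    (hfin : (Function.support f).Finite) : ∑' g, ‖f g‖ₑ ^ p ≠ ⊤ := by
  rw [tsum_eq_sum (s := hfin.toFinset) fun g hg => by
    have : f g = 0 := by simpa using hg
    simp [this, hp]]
  exact ENNReal.sum_ne_top.2 fun g _ => ENNReal.rpow_ne_top_of_nonneg hp.le (by simp)

variable {G : Type u} [Group G]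

/-- Takes the place of Hölder's inequality: the free parameter `t` is later set to `‖f‖_p / ‖∇f‖_p`.
-/
lemma gradEnergy_one_rpow_le (S : Finset G) {p t : ℝ} (hp : 1 ≤ p) (ht : 0 < t) {f : G → ℝ}
    (hf : ∀ g, 0 ≤ f g) :
    gradEnergy S 1 (fun g => f g ^ p) ≤ ENNReal.ofReal p * (ENNReal.ofReal (t ^ (p - 1)) *
      gradEnergy S p f + ENNReal.ofReal (1 / t) * (2 * S.card * ∑' g, ‖f g‖ₑ ^ p)) := by
  have hp0 : 0 ≤ p := by linarith
  have pt : ∀ g h, ‖f g ^ p - f h ^ p‖ₑ ^ (1 : ℝ) ≤ ENNReal.ofReal p *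
      (ENNReal.ofReal (t ^ (p - 1)) * ‖f g - f h‖ₑ ^ p +
        ENNReal.ofReal (1 / t) * (‖f g‖ₑ ^ p + ‖f h‖ₑ ^ p)) := fun g h => by
    have hg := hf g
    have hh := hf h
    rw [ENNReal.rpow_one, enorm_rpow_of_nonneg (hf g) hp0, enorm_rpow_of_nonneg (hf h) hp0,
      Real.enorm_eq_ofReal_abs (f g - f h), ENNReal.ofReal_rpow_of_nonneg (abs_nonneg _) hp0,
      Real.enorm_eq_ofReal_abs, Real.enorm_eq_ofReal (by positivity),
      Real.enorm_eq_ofReal (by positivity), ← ENNReal.ofReal_add (by positivity) (by positivity),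
      ← ENNReal.ofReal_mul (by positivity), ← ENNReal.ofReal_mul (by positivity),
      ← ENNReal.ofReal_add (by positivity) (by positivity), ← ENNReal.ofReal_mul (by positivity)]
    refine ENNReal.ofReal_le_ofReal ((Real.abs_rpow_sub_rpow_le (hf g) (hf h) ht hp).trans
      (le_of_eq ?_))
    ring
  have tr : ∀ s : G, ∑' g, ‖f (g * s)‖ₑ ^ p = ∑' g, ‖f g‖ₑ ^ p := fun s =>
    (Equiv.mulRight s).tsum_eq fun g => ‖f g‖ₑ ^ p
  calc gradEnergy S 1 (fun g => f g ^ p)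
      ≤ ∑' g, ∑ s ∈ S, ENNReal.ofReal p * (ENNReal.ofReal (t ^ (p - 1)) *
        ‖f g - f (g * s)‖ₑ ^ p + ENNReal.ofReal (1 / t) * (‖f g‖ₑ ^ p + ‖f (g * s)‖ₑ ^ p)) :=
        ENNReal.tsum_le_tsum fun g => Finset.sum_le_sum fun s _ => pt g (g * s)
    _ = _ := by
        simp only [← Finset.mul_sum, Finset.sum_add_distrib, ENNReal.tsum_mul_left,
          ENNReal.tsum_add]
        rw [Summable.tsum_finsetSum (f := fun s g => ‖f g‖ₑ ^ p) fun _ _ => ENNReal.summable,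
          Summable.tsum_finsetSum (f := fun s g => ‖f (g * s)‖ₑ ^ p) fun _ _ => ENNReal.summable]
        simp only [tr, Finset.sum_const, nsmul_eq_mul, gradEnergy]
        ring

/-- The `ℓ^p`-profile is dominated by the `ℓ^1`-profile. -/
lemma exists_isoProfile_le_isoProfile_one (S : Finset G) {p : ℝ} (hp : 1 ≤ p) :
    ∃ C : ℝ, 1 ≤ C ∧ ∀ x : ℝ, isoProfile S p x ≤ ENNReal.ofReal C * isoProfile S 1 x := by
  have hp0 : 0 < p := by linarith
  have hc0 : (0 : ℝ) ≤ S.card := S.card.cast_nonneg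
  refine ⟨p * (1 + 2 * S.card), by nlinarith, fun x => isoProfile_le fun f h1 h2 h3 => ?_⟩
  set C : ℝ := p * (1 + 2 * S.card) with hCdef
  have hC : 0 < C := by positivity
  have hsupp : Function.support (fun g => f g ^ p) = Function.support f := by
    ext g
    simp [Real.rpow_eq_zero (h1 g) hp0.ne']
  have key : pNorm 1 (fun g => f g ^ p) / gradNorm S 1 (fun g => f g ^ p) ≤ isoProfile S 1 x :=
    le_isoProfile (fun g => Real.rpow_nonneg (h1 g) p) (by rwa [hsupp]) (by rwa [hsupp])
  have eN : pNorm 1 (fun g => f g ^ p) = ∑' g, ‖f g‖ₑ ^ p := by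
    simp [pNorm, enorm_rpow_of_nonneg (h1 _) hp0.le]
  have eE : gradNorm S 1 (fun g => f g ^ p) = gradEnergy S 1 (fun g => f g ^ p) := by
    simp [gradNorm, gradEnergy]
  rw [eN, eE] at key
  have hNtop := tsum_enorm_rpow_ne_top hp0 h2
  set N := ∑' g, ‖f g‖ₑ ^ p with hN
  have ePN : pNorm p f = N ^ (1 / p) := rfl
  have ePE : gradNorm S p f = gradEnergy S p f ^ (1 / p) := rfl
  rcases eq_or_ne N 0 with hN0 | hN0
  · rw [ePN, hN0, ENNReal.zero_rpow_of_pos (by positivity), ENNReal.zero_div]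
    exact zero_le
  rcases eq_or_ne (gradEnergy S p f) ⊤ with hE | hE
  · rw [ePE, hE, ENNReal.top_rpow_of_pos (by positivity), ENNReal.div_top]
    exact zero_le
  -- The gradient of a nonzero function may vanish, for instance if `S` is empty; both ratios are
  -- then infinite.
  rcases eq_or_ne (gradEnergy S p f) 0 with hE0 | hE0
  · have : gradEnergy S 1 (fun g => f g ^ p) = 0 := by
      simp only [gradEnergy, ENNReal.tsum_eq_zero, Finset.sum_eq_zero_iff] at hE0 ⊢
      intro g s hs
      have := hE0 g s hs
      rw [ENNReal.rpow_eq_zero_iff_of_pos hp0, enorm_eq_zero, sub_eq_zero] at this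
      simp [← this]
    rw [this, ENNReal.div_zero hN0, top_le_iff] at key
    rw [key, ENNReal.mul_top (by simpa using hC)]
    exact le_top
  have hn : N ^ (1 / p) ≠ ⊤ := ENNReal.rpow_ne_top_of_nonneg (by positivity) hNtop
  have he : gradEnergy S p f ^ (1 / p) ≠ ⊤ := ENNReal.rpow_ne_top_of_nonneg (by positivity) hE
  obtain ⟨n, hn0, hnN⟩ : ∃ n : ℝ, 0 < n ∧ N ^ (1 / p) = ENNReal.ofReal n := by
    refine ⟨_, ENNReal.toReal_pos ?_ hn, (ENNReal.ofReal_toReal hn).symm⟩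
    simp [ENNReal.rpow_eq_zero_iff, hN0, hNtop]
  obtain ⟨e, he0, heE⟩ : ∃ e : ℝ, 0 < e ∧ gradEnergy S p f ^ (1 / p) = ENNReal.ofReal e := by
    refine ⟨_, ENNReal.toReal_pos ?_ he, (ENNReal.ofReal_toReal he).symm⟩
    simp [ENNReal.rpow_eq_zero_iff, hE0, hE]
  have inv : ∀ (M : ℝ≥0∞) (m : ℝ), 0 < m → M ^ (1 / p) = ENNReal.ofReal m →
      M = ENNReal.ofReal (m ^ p) := fun M m hm h => by
    rw [← ENNReal.ofReal_rpow_of_pos hm, ← h, ← ENNReal.rpow_mul, one_div_mul_cancel hp0.ne',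
      ENNReal.rpow_one]
  have hN' := inv _ _ hn0 hnN
  have hE' := inv _ _ he0 heE
  -- With `t = n / e` both terms become multiples of `n ^ (p - 1) * e`.
  have hup := gradEnergy_one_rpow_le S hp (div_pos hn0 he0) h1
  rw [← hN, hN', hE'] at hup
  have hup' : gradEnergy S 1 (fun g => f g ^ p) ≤ ENNReal.ofReal (C * (n ^ (p - 1) * e)) := by
    refine hup.trans (le_of_eq ?_)
    have hcard : (2 * S.card : ℝ≥0∞) = ENNReal.ofReal (2 * S.card) := by
      rw [ENNReal.ofReal_mul (by norm_num)]; simp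
    rw [hcard, ← ENNReal.ofReal_mul (by positivity), ← ENNReal.ofReal_mul (by positivity),
      ← ENNReal.ofReal_mul (by positivity), ← ENNReal.ofReal_add (by positivity) (by positivity),
      ← ENNReal.ofReal_mul (by positivity)]
    congr 1
    rw [Real.div_rpow hn0.le he0.le, Real.rpow_sub hn0, Real.rpow_sub he0, Real.rpow_one,
      Real.rpow_one, hCdef]
    have := Real.rpow_pos_of_pos he0 p
    field_simp
  rw [ePN, ePE, hnN, heE]
  refine le_trans ?_ (mul_le_mul_right key _)
  rw [hN']
  calc ENNReal.ofReal n / ENNReal.ofReal e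
      = ENNReal.ofReal C * (ENNReal.ofReal (n ^ p) / ENNReal.ofReal (C * (n ^ (p - 1) * e))) := by
        rw [← ENNReal.ofReal_div_of_pos he0, ← ENNReal.ofReal_div_of_pos (by positivity),
          ← ENNReal.ofReal_mul hC.le]
        congr 1
        rw [Real.rpow_sub hn0, Real.rpow_one]
        have := Real.rpow_pos_of_pos hn0 p
        field_simp
    _ ≤ _ := by gcongr

end Exponents

/-! ### The generalised inverse of `φ` -/

section ComparisonFunctions

variable {Λ : ℕ → ℕ}

lemma phiInv_nonneg (y : ℝ) : 0 ≤ phiInv Λ y := Real.sSup_nonneg fun _ h => h.1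

/-- Bounds the set whose supremum is `phiInv Λ y`; for an unbounded set `sSup` would take its
default value `0`. -/
lemma le_of_phi_le (h1 : ∀ m, 1 ≤ Λ m) {t y : ℝ} (ht : 0 ≤ t) (h : phi Λ t ≤ y) : t ≤ y := by
  refine le_trans ?_ h
  have : (1 : ℝ) ≤ Λ ⌊t⌋₊ := by exact_mod_cast h1 _
  unfold phi; nlinarith

lemma phiInv_mono (h1 : ∀ m, 1 ≤ Λ m) : Monotone (phiInv Λ) := by
  intro x y hxy
  by_cases hne : {t : ℝ | 0 ≤ t ∧ phi Λ t ≤ x}.Nonempty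
  · exact csSup_le_csSup ⟨y, fun t ht => le_of_phi_le h1 ht.1 ht.2⟩ hne
      fun t ht => ⟨ht.1, ht.2.trans hxy⟩
  -- This is the case `x < 0`, where `phiInv` has the default value `0`.
  · rw [Set.not_nonempty_iff_eq_empty] at hne
    rw [phiInv, hne, Real.sSup_empty]
    exact phiInv_nonneg y

lemma psi_mono (h1 : ∀ m, 1 ≤ Λ m) {C : ℝ} (hC : 0 < C) : Monotone (psi Λ C) := fun _ _ h =>
  mul_le_mul_of_nonneg_left (phiInv_mono h1 h) (by positivity)

lemma psi_anti {C D : ℝ} (hC : 0 < C) (h : C ≤ D) (x : ℝ) : psi Λ D x ≤ psi Λ C x :=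
  mul_le_mul_of_nonneg_right (one_div_le_one_div_of_le hC h) (phiInv_nonneg x)

lemma iterate_psi_anti (h1 : ∀ m, 1 ≤ Λ m) {C D : ℝ} (hC : 0 < C) (h : C ≤ D) (n : ℕ) (x : ℝ) :
    (psi Λ D)^[n] x ≤ (psi Λ C)^[n] x :=
  (psi_mono h1 (hC.trans_le h)).iterate_le_of_le (fun y => psi_anti hC h y) n x

/-- The supremum need not be attained, hence the strict hypothesis: some `t > a` lies in the set,
and monotonicity of `Λ` descends from `t` to `a`. -/
lemma mul_le_of_lt_phiInv (hmono : Monotone Λ) {a : ℕ} {y : ℝ}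
    (h : (a : ℝ) < phiInv Λ y) : (a : ℝ) * Λ a ≤ y := by
  have hne : {t : ℝ | 0 ≤ t ∧ phi Λ t ≤ y}.Nonempty := by
    by_contra hne
    rw [Set.not_nonempty_iff_eq_empty] at hne
    rw [phiInv, hne, Real.sSup_empty] at h
    exact absurd h (not_lt.2 a.cast_nonneg)
  obtain ⟨t, ⟨ht0, ht⟩, hat⟩ := exists_lt_of_lt_csSup hne h
  refine le_trans ?_ ht
  have : (Λ a : ℝ) ≤ Λ ⌊t⌋₊ := by exact_mod_cast hmono (Nat.le_floor hat.le)
  unfold phi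
  gcongr

end ComparisonFunctions

/-! ### Lamp growth, and the lower bound for one halo product -/

namespace EquivariantHalo

variable {K : Type u} [Group K] (𝓛 : EquivariantHalo K)

lemma lampGrowth_card (hc : 𝓛.ConsistentBlocks) (S : Finset K) :
    𝓛.lampGrowth S.card = Nat.card (𝓛.L (S : Set K)) := by
  have h : ∃ R : Finset K, R.card = S.card := ⟨S, rfl⟩
  rw [lampGrowth, dif_pos h]
  exact hc.2 _ _ h.choose_spec

lemma one_le_lampGrowth [Infinite K] (hc : 𝓛.ConsistentBlocks) (m : ℕ) : 1 ≤ 𝓛.lampGrowth m := by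
  obtain ⟨S, rfl⟩ := Infinite.exists_subset_card_eq K m
  rw [lampGrowth_card 𝓛 hc]
  have := hc.1 S
  exact Nat.card_pos

lemma card_L_le_of_subset (hc : 𝓛.ConsistentBlocks) {R S : Finset K} (h : R ⊆ S) :
    Nat.card (𝓛.L (R : Set K)) ≤ Nat.card (𝓛.L (S : Set K)) := by
  have := hc.1 S
  exact Nat.card_le_card_of_injective _
    (Subgroup.inclusion_injective (𝓛.mono _ _ (Finset.coe_subset.2 h)))

lemma lampGrowth_mono [Infinite K] (hc : 𝓛.ConsistentBlocks) : Monotone 𝓛.lampGrowth := by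
  intro m k hmk
  obtain ⟨R, rfl⟩ := Infinite.exists_subset_card_eq K m
  obtain ⟨S, hRS, rfl⟩ := Infinite.exists_superset_card_eq R k hmk
  rw [lampGrowth_card 𝓛 hc, lampGrowth_card 𝓛 hc]
  exact card_L_le_of_subset 𝓛 hc hRS

lemma exists_mem_L_ne_one [Nontrivial 𝓛.Lamp] :
    ∃ (P : Finset K) (τ : 𝓛.Lamp), τ ∈ 𝓛.L (P : Set K) ∧ τ ≠ 1 := by
  by_contra! h
  have : (⨆ S : Finset K, 𝓛.L (S : Set K)) = ⊥ := by
    rw [eq_bot_iff]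
    exact iSup_le fun S τ hτ => Subgroup.mem_bot.2 (h S τ hτ)
  rw [𝓛.iSup_finite] at this
  exact top_ne_bot this

/-- With `exists_one_lt_lampGrowth`, this carries nontriviality of the lamps from the first floor of
the tower to the others, through the common growth sequence. -/
lemma nontrivial_lamp_of_lampGrowth {m : ℕ}
    (h : 1 < 𝓛.lampGrowth m) : Nontrivial 𝓛.Lamp := by
  by_contra hn
  rw [not_nontrivial_iff_subsingleton] at hn
  rw [lampGrowth] at h
  split_ifs at h with hS
  · rw [Nat.card_eq_one_iff_unique.2 ⟨inferInstance, inferInstance⟩] at h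
    omega
  · omega

lemma exists_one_lt_lampGrowth [Nontrivial 𝓛.Lamp] (hc : 𝓛.ConsistentBlocks) :
    ∃ m, 1 < 𝓛.lampGrowth m := by
  obtain ⟨P, τ, hτ, hne⟩ := 𝓛.exists_mem_L_ne_one
  refine ⟨P.card, ?_⟩
  rw [lampGrowth_card 𝓛 hc]
  have := hc.1 P
  have : Nontrivial (𝓛.L (P : Set K)) := ⟨⟨τ, hτ⟩, 1, fun h => hne (congrArg Subtype.val h)⟩
  exact Finite.one_lt_card

lemma α_mem_L {P : Set K} {τ : 𝓛.Lamp} (hτ : τ ∈ 𝓛.L P) (h : K) : 𝓛.α h τ ∈ 𝓛.L (h • P) := by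
  rw [← 𝓛.map_α]
  exact Subgroup.mem_map_of_mem _ hτ

lemma tsum_product (F : 𝓛.Product → ℝ≥0∞) :
    ∑' g, F g = ∑' σ : 𝓛.Lamp, ∑' h : K, F ⟨σ, h⟩ := by
  rw [← ENNReal.tsum_prod (f := fun σ h => F ⟨σ, h⟩)]
  exact (SemidirectProduct.equivProd.symm.tsum_eq F).symm

open Classical in
/-- The natural generators `(1, s)` and `(σ, 1)`. -/
lemma exists_finset_generators {T : Finset K} (hc : 𝓛.ConsistentBlocks)
    (hgen : Subgroup.closure
      ({x : 𝓛.Product | ∃ s ∈ T, x = SemidirectProduct.inr s} ∪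
        {x : 𝓛.Product | ∃ s ∈ T, ∃ σ ∈ 𝓛.L {1, s}, x = SemidirectProduct.inl σ}) = ⊤) :
    ∃ V : Finset 𝓛.Product, (∀ v ∈ V, ∃ s ∈ T, ∃ σ ∈ 𝓛.L {1, s}, v = SemidirectProduct.inl σ) ∧
      IsGeneratingSet (T.image (SemidirectProduct.inr (φ := 𝓛.α)) ∪ V) := by
  have hfin : {x : 𝓛.Product | ∃ s ∈ T, ∃ σ ∈ 𝓛.L {1, s}, x = SemidirectProduct.inl σ}.Finite := by
    have : {x : 𝓛.Product | ∃ s ∈ T, ∃ σ ∈ 𝓛.L {1, s}, x = SemidirectProduct.inl σ} =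
        ⋃ s ∈ T, SemidirectProduct.inl '' (𝓛.L {1, s} : Set 𝓛.Lamp) := by
      ext x
      simp only [Set.mem_ofPred_eq, Set.mem_iUnion, Set.mem_image, exists_prop, SetLike.mem_coe]
      constructor
      · rintro ⟨s, hs, σ, hσ, rfl⟩; exact ⟨s, hs, σ, hσ, rfl⟩
      · rintro ⟨s, hs, σ, hσ, rfl⟩; exact ⟨s, hs, σ, hσ, rfl⟩
    rw [this]
    refine T.finite_toSet.biUnion fun s _ => Set.Finite.image _ ?_
    have := hc.1 {1, s}
    rw [Finset.coe_pair] at this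
    exact this
  refine ⟨hfin.toFinset, fun v hv => by simpa using hv, ?_⟩
  rw [IsGeneratingSet, ← hgen]
  congr 1
  ext x
  simp [eq_comm]

open Classical in
/-- Extending a function on the base by the indicator of a finite block of lamps. -/
lemma isoProfile_le_isoProfile_product [Infinite K] (hc : 𝓛.ConsistentBlocks) {T : Finset K}
    {V : Finset 𝓛.Product}
    (hV : ∀ v ∈ V, ∃ s ∈ T, ∃ σ ∈ 𝓛.L {1, s}, v = SemidirectProduct.inl σ)
    {p : ℝ} (hp : 1 ≤ p) {C : ℝ} (hC : 1 + (T.card : ℝ) < C) (x : ℝ) :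
    isoProfile T p (psi 𝓛.lampGrowth C x) ≤
      isoProfile (T.image (SemidirectProduct.inr (φ := 𝓛.α)) ∪ V) p x := by
  have hp0 : 0 < p := by linarith
  have hC0 : 0 < C := by have : (0 : ℝ) ≤ T.card := Nat.cast_nonneg _; linarith
  refine isoProfile_le fun f h1 h2 h3 => ?_
  by_cases hf0 : f = 0
  · subst hf0
    simp [pNorm, hp0]
  set F : Finset K := h2.toFinset with hF
  have hFcard : (Function.support f).ncard = F.card := Set.ncard_eq_toFinset_card _ h2
  have hFpos : 0 < F.card := by
    rw [Finset.card_pos]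
    obtain ⟨g, hg⟩ := Function.ne_iff.1 hf0
    exact ⟨g, by simpa [hF] using hg⟩
  -- The set contains `h` and `h * s` for `h ∈ F`, `s ∈ T`, so the lamp generators used at positions
  -- of `F` act within `M`.
  set F' : Finset K := F ∪ F * T with hF'
  have hF'card : F'.card ≤ F.card * (1 + T.card) := by
    refine (Finset.card_union_le _ _).trans ?_
    rw [mul_add, mul_one]
    exact Nat.add_le_add_left Finset.card_mul_le _
  set M : Subgroup 𝓛.Lamp := 𝓛.L (F' : Set K) with hM
  have : Finite M := hc.1 F'
  set E : 𝓛.Product → ℝ := fun g => if g.left ∈ M then f g.right else 0 with hE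
  have hsupp : Function.support E = SemidirectProduct.equivProd ⁻¹' ((M : Set 𝓛.Lamp) ×ˢ (F : Set K)) := by
    ext g
    simp [hE, hF, SemidirectProduct.equivProd]
  have hMfin : (M : Set 𝓛.Lamp).Finite := Set.toFinite _
  have hsfin : (Function.support E).Finite := by
    rw [hsupp]
    exact (hMfin.prod F.finite_toSet).preimage SemidirectProduct.equivProd.injective.injOn
  have hscard : (Function.support E).ncard = Nat.card M * F.card := by
    rw [hsupp, Set.ncard_preimage_of_injective_subset_range SemidirectProduct.equivProd.injective
      (by simp [SemidirectProduct.equivProd.surjective.range_eq]), Set.ncard_prod,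
      Set.ncard_coe_finset]
    rfl
  have hbound : ((Function.support E).ncard : ℝ) ≤ x := by
    -- Strictness, needed since the supremum may not be attained, comes from `1 + T.card < C` and
    -- `F` being nonempty.
    have hlt : ((F.card * (1 + T.card) : ℕ) : ℝ) < phiInv 𝓛.lampGrowth x := by
      rw [hFcard, psi, one_div, ← div_eq_inv_mul, le_div_iff₀ hC0] at h3
      refine lt_of_lt_of_le ?_ h3
      push_cast
      have : (0 : ℝ) < F.card := by exact_mod_cast hFpos
      gcongr
    refine le_trans ?_ (mul_le_of_lt_phiInv (𝓛.lampGrowth_mono hc) hlt)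
    rw [hscard, hM, ← lampGrowth_card 𝓛 hc]
    have := 𝓛.lampGrowth_mono hc hF'card
    have h5 : F.card ≤ F.card * (1 + T.card) := Nat.le_mul_of_pos_right _ (by omega)
    rw [mul_comm]
    exact_mod_cast Nat.mul_le_mul h5 this
  have sumM : ∀ c : ℝ≥0∞, ∑' σ : 𝓛.Lamp, (if σ ∈ M then c else 0) = Nat.card M * c := fun c => by
    rw [tsum_eq_sum (s := hMfin.toFinset) fun σ hσ => if_neg (by simpa using hσ),
      Finset.sum_congr rfl fun σ hσ => if_pos (by simpa using hσ), Finset.sum_const,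
      nsmul_eq_mul, ← Nat.card_eq_card_finite_toFinset hMfin]
    rfl
  have hMpos : (Nat.card M : ℝ≥0∞) ≠ 0 := by
    have : 0 < Nat.card M := Nat.card_pos
    exact_mod_cast this.ne'
  have hnorm : pNorm p E = (Nat.card M : ℝ≥0∞) ^ (1 / p) * pNorm p f := by
    rw [pNorm, pNorm, ← ENNReal.mul_rpow_of_nonneg _ _ (by positivity), 𝓛.tsum_product, ← sumM]
    congr 1
    refine tsum_congr fun σ => ?_
    split_ifs with hσ
    · simp [hE, hσ]
    · simp [hE, hσ, hp0]
  have hgrad : gradNorm (T.image (SemidirectProduct.inr (φ := 𝓛.α)) ∪ V) p E ≤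
      (Nat.card M : ℝ≥0∞) ^ (1 / p) * gradNorm T p f := by
    rw [gradNorm, gradNorm, ← ENNReal.mul_rpow_of_nonneg _ _ (by positivity), 𝓛.tsum_product,
      ← sumM]
    refine ENNReal.rpow_le_rpow (ENNReal.tsum_le_tsum fun σ => ?_) (by positivity)
    rw [show (if σ ∈ M then ∑' g, ∑ s ∈ T, ‖f g - f (g * s)‖ₑ ^ p else 0) =
      ∑' g, ∑ s ∈ T, if σ ∈ M then ‖f g - f (g * s)‖ₑ ^ p else 0 by split_ifs <;> simp]
    refine ENNReal.tsum_le_tsum fun h => ?_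
    have hzero : ∀ v ∈ V, ‖E ⟨σ, h⟩ - E (⟨σ, h⟩ * v)‖ₑ ^ p = 0 := fun v hv => by
      obtain ⟨s, hs, τ, hτ, rfl⟩ := hV v hv
      have : E (⟨σ, h⟩ * SemidirectProduct.inl τ) = E ⟨σ, h⟩ := by
        simp only [hE, SemidirectProduct.mul_left, SemidirectProduct.mul_right,
          SemidirectProduct.left_inl, SemidirectProduct.right_inl, mul_one]
        by_cases hh : f h = 0
        · simp [hh]
        have hhF : h ∈ F := by simpa [hF] using hh
        have hτM : 𝓛.α h τ ∈ M := by
          refine 𝓛.mono _ _ ?_ (𝓛.α_mem_L hτ h)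
          rintro _ ⟨y, rfl | rfl, rfl⟩ <;>
            simp only [smul_eq_mul, mul_one, hF', Finset.mem_coe, Finset.mem_union]
          exacts [Or.inl hhF, Or.inr (Finset.mul_mem_mul hhF hs)]
        simp [M.mul_mem_cancel_right hτM]
      rw [this, sub_self]
      simp [hp0]
    rw [← Finset.union_sdiff_self_eq_union, Finset.sum_union Finset.disjoint_sdiff,
      Finset.sum_eq_zero (s := V \ _) fun v hv => hzero v (Finset.mem_sdiff.1 hv).1, add_zero,
      Finset.sum_image SemidirectProduct.inr_injective.injOn]
    refine Finset.sum_le_sum fun s _ => le_of_eq ?_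
    by_cases hσ : σ ∈ M <;> simp [hE, hσ, hp0]
  calc pNorm p f / gradNorm T p f
      = pNorm p E / ((Nat.card M : ℝ≥0∞) ^ (1 / p) * gradNorm T p f) := by
        rw [hnorm, ENNReal.mul_div_mul_left]
        · simp [ENNReal.rpow_eq_zero_iff, hMpos]
        · exact ENNReal.rpow_ne_top_of_nonneg (by positivity) (by simp)
    _ ≤ pNorm p E / gradNorm (T.image (SemidirectProduct.inr (φ := 𝓛.α)) ∪ V) p E :=
        ENNReal.div_le_div_left hgrad _
    _ ≤ _ := le_isoProfile (fun g => by simp only [hE]; split_ifs; exacts [h1 _, le_rfl]) hsfin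
        hbound

end EquivariantHalo

/-! ### Edges of a finite set in almost independent directions -/

section EdgeIsoperimetry

/-- The gain `min a b * log 2` pays for the edges between the two halves of a split set. It comes
from the smaller half, as `a + b` is at least twice the minimum. -/
lemma Real.mul_log_add_min_le {a b : ℝ} (ha : 0 < a) (hb : 0 < b) :
    a * Real.log a + b * Real.log b + min a b * Real.log 2 ≤ (a + b) * Real.log (a + b) := by
  wlog h : a ≤ b generalizing a b
  · have := this hb ha (le_of_not_ge h)
    rw [min_comm, add_comm a b]; linarith
  rw [min_eq_left h]
  have h1 : Real.log b ≤ Real.log (a + b) := Real.log_le_log hb (by linarith)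
  have h2 : Real.log a + Real.log 2 ≤ Real.log (a + b) := by
    rw [← Real.log_mul ha.ne' (by norm_num)]
    exact Real.log_le_log (by positivity) (by linarith)
  nlinarith

open Classical in
/-- An edge-isoperimetric inequality: a finite set `V` spans few edges in directions `τ i` that are
almost independent of each other. -/
lemma sum_card_edges_le {Γ ι : Type*} [Group Γ] (Y : Finset ι) (τ : ι → Γ) (Q : ι → Subgroup Γ)
    (hτ : ∀ i ∈ Y, τ i ∉ Q i) (N : ℕ) (hN : ∀ i ∈ Y, (Y.filter fun j => τ j ∉ Q i).card ≤ N)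
    (V : Finset Γ) :
    (∑ i ∈ Y, ((V.filter fun σ => σ * τ i ∈ V).card : ℝ)) * Real.log 2 ≤
      2 * N * (V.card * Real.log V.card) := by
  induction hk : V.card using Nat.strong_induction_on generalizing V with
  | _ k ih =>
  by_cases hne : ∃ i ∈ Y, ∃ σ ∈ V, σ * τ i ∈ V
  swap
  · push Not at hne
    rw [Finset.sum_eq_zero fun i hi => by
      rw [Finset.filter_false_of_mem fun σ hσ => hne i hi σ hσ]; simp, zero_mul]
    have := Real.log_natCast_nonneg k
    positivity
  obtain ⟨i, hi, σ₀, hσ₀, hσ₁⟩ := hne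
  -- Split `V` by the coset `σ₀ Q i`. Both parts are nonempty, since the edge from `σ₀` to `σ₀ * τ
  -- i` leaves the coset. Directions in `Q i` respect the split, so at most `N` directions cross it,
  -- each with at most `2 * min |V₀| |V₁|` edges.
  set V₀ := V.filter fun σ => σ₀⁻¹ * σ ∈ Q i with hV₀
  set V₁ := V.filter fun σ => σ₀⁻¹ * σ ∉ Q i with hV₁
  have hadd : V₀.card + V₁.card = k := by
    rw [← hk]; exact Finset.card_filter_add_card_filter_not _
  have h0 : 0 < V₀.card := Finset.card_pos.2 ⟨σ₀, by simp [hV₀, hσ₀, (Q i).one_mem]⟩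
  have h1 : 0 < V₁.card := Finset.card_pos.2 ⟨σ₀ * τ i, by simp [hV₁, hσ₁, hτ i hi]⟩
  have cross : ∀ (j : ι) (W W' : Finset Γ),
      (W.filter fun σ => σ * τ j ∈ W').card ≤ min W.card W'.card := fun j W W' => by
    refine le_min (Finset.card_filter_le _ _) ?_
    refine Finset.card_le_card_of_injOn (fun σ => σ * τ j) (fun σ hσ => ?_)
      fun _ _ _ _ h => mul_right_cancel h
    exact (Finset.mem_filter.1 hσ).2
  have step : ∀ j ∈ Y, (V.filter fun σ => σ * τ j ∈ V).card ≤
      (V₀.filter fun σ => σ * τ j ∈ V₀).card + (V₁.filter fun σ => σ * τ j ∈ V₁).card +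
        if τ j ∉ Q i then 2 * min V₀.card V₁.card else 0 := by
    intro j _
    have hsub : (V.filter fun σ => σ * τ j ∈ V) ⊆ ((V₀.filter fun σ => σ * τ j ∈ V₀) ∪
        (V₁.filter fun σ => σ * τ j ∈ V₁)) ∪ ((V₀.filter fun σ => σ * τ j ∈ V₁) ∪
          (V₁.filter fun σ => σ * τ j ∈ V₀)) := by
      intro σ
      simp only [Finset.mem_filter, Finset.mem_union, hV₀, hV₁]
      tauto
    refine (Finset.card_le_card hsub).trans ((Finset.card_union_le _ _).trans ?_)
    refine add_le_add (Finset.card_union_le _ _) ?_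
    split_ifs with hj
    · have hj' : ∀ σ, σ₀⁻¹ * (σ * τ j) ∈ Q i ↔ σ₀⁻¹ * σ ∈ Q i := fun σ => by
        rw [← mul_assoc]; exact (Q i).mul_mem_cancel_right hj
      rw [Nat.le_zero, Finset.card_eq_zero, Finset.union_eq_empty]
      constructor <;>
      · refine Finset.filter_false_of_mem fun σ hσ hσ' => ?_
        simp only [hV₀, hV₁, Finset.mem_filter, hj'] at hσ hσ'
        tauto
    · refine (Finset.card_union_le _ _).trans ?_
      have e1 := cross j V₀ V₁
      have e2 := cross j V₁ V₀
      rw [min_comm] at e2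
      omega
  have hsum : ∑ j ∈ Y, ((V.filter fun σ => σ * τ j ∈ V).card : ℝ) ≤
      ∑ j ∈ Y, ((V₀.filter fun σ => σ * τ j ∈ V₀).card : ℝ) +
        ∑ j ∈ Y, ((V₁.filter fun σ => σ * τ j ∈ V₁).card : ℝ) +
        2 * N * min (V₀.card : ℝ) V₁.card := by
    have h2 : ∑ j ∈ Y, (V.filter fun σ => σ * τ j ∈ V).card ≤
        ∑ j ∈ Y, (V₀.filter fun σ => σ * τ j ∈ V₀).card +
          ∑ j ∈ Y, (V₁.filter fun σ => σ * τ j ∈ V₁).card + 2 * N * min V₀.card V₁.card := by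
      refine (Finset.sum_le_sum step).trans ?_
      rw [Finset.sum_add_distrib, Finset.sum_add_distrib, ← Finset.sum_filter, Finset.sum_const,
        smul_eq_mul]
      have := Nat.mul_le_mul_right (2 * min V₀.card V₁.card) (hN i hi)
      linarith
    exact_mod_cast h2
  have i0 := ih V₀.card (by omega) V₀ rfl
  have i1 := ih V₁.card (by omega) V₁ rfl
  have hlog := Real.mul_log_add_min_le (a := V₀.card) (b := V₁.card) (by exact_mod_cast h0)
    (by exact_mod_cast h1)
  have hk' : (k : ℝ) = V₀.card + V₁.card := by exact_mod_cast hadd.symm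
  rw [hk']
  have hl2 : 0 ≤ Real.log 2 := Real.log_nonneg (by norm_num)
  have a1 := mul_le_mul_of_nonneg_right hsum hl2
  have a2 := mul_le_mul_of_nonneg_left hlog (by positivity : (0 : ℝ) ≤ 2 * N)
  linarith

end EdgeIsoperimetry

/-! ### Reduction of the `ℓ^1`-profile to finite sets -/

section Coarea

lemma tsum_enorm_indicator {G : Type u} (A : Finset G) :
    ∑' g, ‖(A : Set G).indicator (1 : G → ℝ) g‖ₑ = A.card := by
  rw [tsum_eq_sum (s := A) fun g hg => by simp [hg], Finset.sum_congr rfl (g := fun _ => 1)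
    fun g hg => by simp [hg]]
  simp

variable {G : Type u} [Group G]

lemma gradEnergy_one_le (S : Finset G) (f : G → ℝ) :
    gradEnergy S 1 f ≤ 2 * S.card * ∑' g, ‖f g‖ₑ := by
  have tr : ∀ s : G, ∑' g, ‖f (g * s)‖ₑ = ∑' g, ‖f g‖ₑ := fun s =>
    (Equiv.mulRight s).tsum_eq fun g => ‖f g‖ₑ
  calc gradEnergy S 1 f ≤ ∑' g, ∑ s ∈ S, (‖f g‖ₑ + ‖f (g * s)‖ₑ) :=
        ENNReal.tsum_le_tsum fun g => Finset.sum_le_sum fun s _ => by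
          rw [ENNReal.rpow_one]; exact enorm_sub_le
    _ = _ := by
        rw [Summable.tsum_finsetSum fun _ _ => ENNReal.summable]
        simp only [ENNReal.tsum_add, tr, Finset.sum_const, nsmul_eq_mul]
        ring

lemma ratio_indicator_le (S : Finset G) (A : Finset G) {x : ℝ} (hA : (A.card : ℝ) ≤ x) :
    (A.card : ℝ≥0∞) / gradEnergy S 1 ((A : Set G).indicator 1) ≤ isoProfile S 1 x := by
  have hs : Function.support ((A : Set G).indicator (1 : G → ℝ)) = A := by
    rw [Set.support_indicator]; simp
  have := le_isoProfile (S := S) (p := 1) (x := x) (f := (A : Set G).indicator 1)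
    (fun g => Set.indicator_nonneg (by simp) g) (by rw [hs]; exact A.finite_toSet)
    (by rwa [hs, Set.ncard_coe_finset])
  refine le_trans (le_of_eq ?_) this
  simp only [pNorm, gradNorm, ENNReal.rpow_one, tsum_enorm_indicator, gradEnergy, div_one]

/-- To bound the `ℓ^1`-profile it is enough to consider indicator functions. -/
lemma isoProfile_one_le_of_indicator (S : Finset G) {x : ℝ} {c : ℝ≥0∞}
    (h : ∀ A : Finset G, (A.card : ℝ) ≤ x →
      (A.card : ℝ≥0∞) ≤ c * gradEnergy S 1 ((A : Set G).indicator 1)) :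
    isoProfile S 1 x ≤ c := by
  have key : ∀ (k : ℕ) (f : G → ℝ), (∀ g, 0 ≤ f g) → (Function.support f).Finite →
      (Function.support f).ncard = k → (k : ℝ) ≤ x → ∑' g, ‖f g‖ₑ ≤ c * gradEnergy S 1 f := by
    intro k
    induction k using Nat.strong_induction_on with
    | _ k ih =>
    intro f hf hfin hk hkx
    set A := hfin.toFinset with hA
    have hAk : A.card = k := by rw [← hk, Set.ncard_eq_toFinset_card _ hfin]
    have memA : ∀ g, g ∈ A ↔ f g ≠ 0 := fun g => by simp [hA]
    rcases A.eq_empty_or_nonempty with h0 | hne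
    · have : ∀ g, f g = 0 := fun g => by
        by_contra hg; rw [← ne_eq, ← memA, h0] at hg; simp at hg
      simp [this]
    obtain ⟨g₀, hg₀, hmin⟩ := A.exists_min_image f hne
    set a := f g₀
    have ha : 0 ≤ a := hf g₀
    set e : G → ℝ := (A : Set G).indicator 1 with he
    have eval : ∀ g, (f g = 0 ∧ e g = 0) ∨ (a ≤ f g ∧ e g = 1) := fun g => by
      by_cases hg : g ∈ A
      · exact Or.inr ⟨hmin g hg, by simp [he, hg]⟩
      · exact Or.inl ⟨by simpa [memA] using hg, by simp [he, hg]⟩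
    -- Removing the lowest layer kills `f` at the minimiser `g₀`, so the support shrinks and
    -- induction applies.
    set f' : G → ℝ := fun g => f g - a * e g with hf'
    have hf'0 : ∀ g, 0 ≤ f' g := fun g => by
      rcases eval g with ⟨h1, h2⟩ | ⟨h1, h2⟩ <;> simp [hf', h1, h2]
    have hss : Function.support f' ⊂ Function.support f := by
      refine ⟨fun g hg => ?_, fun hsub => ?_⟩
      · rcases eval g with ⟨h1, h2⟩ | ⟨h1, h2⟩
        · simp [hf', h1, h2] at hg
        · exact fun h3 => (memA g).1 (by by_contra h4; simp [he, h4] at h2) h3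
      · have := hsub ((memA g₀).1 hg₀)
        have h2 : e g₀ = 1 := by simp [he, hg₀]
        simp [hf', h2, a] at this
    have hlt : (Function.support f').ncard < k := hk ▸ Set.ncard_lt_ncard hss hfin
    have IH := ih _ hlt f' hf'0 (hfin.subset hss.subset) rfl
      (le_trans (by exact_mod_cast hlt.le) hkx)
    have hA' := h A (by rwa [hAk])
    have n1 : ∑' g, ‖f g‖ₑ = ENNReal.ofReal a * A.card + ∑' g, ‖f' g‖ₑ := by
      rw [← tsum_enorm_indicator A, ← ENNReal.tsum_mul_left, ← ENNReal.tsum_add]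
      refine tsum_congr fun g => ?_
      have e0 : 0 ≤ e g := by rcases eval g with ⟨_, h2⟩ | ⟨_, h2⟩ <;> simp [h2]
      rw [← he, Real.enorm_eq_ofReal (hf g), Real.enorm_eq_ofReal e0, Real.enorm_eq_ofReal (hf'0 g),
        ← ENNReal.ofReal_mul ha, ← ENNReal.ofReal_add (by positivity) (hf'0 g)]
      simp [hf']
    -- No cancellation occurs: along each edge the increments of `a * e` and of `f'` never have
    -- opposite signs.
    have n2 : gradEnergy S 1 f = ENNReal.ofReal a * gradEnergy S 1 e + gradEnergy S 1 f' := by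
      rw [gradEnergy, gradEnergy, gradEnergy, ← ENNReal.tsum_mul_left, ← ENNReal.tsum_add]
      refine tsum_congr fun g => ?_
      rw [Finset.mul_sum, ← Finset.sum_add_distrib]
      refine Finset.sum_congr rfl fun s _ => ?_
      simp only [ENNReal.rpow_one, Real.enorm_eq_ofReal_abs]
      rw [← ENNReal.ofReal_mul ha, ← ENNReal.ofReal_add (by positivity) (abs_nonneg _)]
      congr 1
      rcases eval g with ⟨h1, h2⟩ | ⟨h1, h2⟩ <;> rcases eval (g * s) with ⟨h3, h4⟩ | ⟨h3, h4⟩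
      · simp [hf', h1, h2, h3, h4]
      · simp only [hf', h1, h2, h4]
        rw [abs_of_nonpos (by linarith), abs_of_nonpos (by linarith), abs_of_nonpos (by linarith)]
        ring
      · simp only [hf', h3, h2, h4]
        rw [abs_of_nonneg (by linarith), abs_of_nonneg (by linarith), abs_of_nonneg (by linarith)]
        ring
      · simp [hf', h2, h4]
    rw [n1, n2, mul_add]
    refine add_le_add ?_ IH
    calc ENNReal.ofReal a * (A.card : ℝ≥0∞) ≤ ENNReal.ofReal a * (c * gradEnergy S 1 e) := by
          gcongr
      _ = _ := by ring
  refine isoProfile_le fun f h1 h2 h3 => ENNReal.div_le_of_le_mul ?_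
  have := key _ f h1 h2 rfl h3
  simpa [pNorm, gradNorm, gradEnergy] using this

end Coarea

/-! ### The upper bound for one halo product -/

namespace EquivariantHalo

variable {K : Type u} [Group K] (𝓛 : EquivariantHalo K)

open Classical in
/-- A finite set of lamp configurations spans few edges in the directions `α h τ`. -/
lemma sum_card_lamp_edges_le {P : Finset K} {τ : 𝓛.Lamp} (hτ : τ ∈ 𝓛.L (P : Set K)) (hτ1 : τ ≠ 1)
    (Y : Finset K) (V : Finset 𝓛.Lamp) :
    (∑ h ∈ Y, ((V.filter fun σ => σ * 𝓛.α h τ ∈ V).card : ℝ)) * Real.log 2 ≤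
      2 * (P * P⁻¹).card * (V.card * Real.log V.card) := by
  -- The lamp `α h τ` lies in `L (h • P)`, which meets `L` of the complement trivially. If `j • P`
  -- misses `h • P`, then `α j τ` lies in that complementary subgroup; otherwise `j ∈ h • (P *
  -- P⁻¹)`.
  refine sum_card_edges_le Y (fun h => 𝓛.α h τ) (fun h => 𝓛.L (h • (P : Set K))ᶜ) ?_ _ ?_ V
  · intro h _ hmem
    have h2 : 𝓛.α h τ ∈ 𝓛.L (h • (P : Set K) ∩ (h • (P : Set K))ᶜ) := by
      rw [𝓛.inter]; exact ⟨𝓛.α_mem_L hτ h, hmem⟩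
    rw [Set.inter_compl_self, 𝓛.empty, Subgroup.mem_bot] at h2
    exact hτ1 ((map_eq_one_iff _ (𝓛.α h).injective).1 h2)
  · intro h _
    rw [← Finset.card_smul_finset h (P * P⁻¹)]
    refine Finset.card_le_card fun j hj => ?_
    rw [Finset.mem_filter] at hj
    by_contra hnot
    refine hj.2 (𝓛.mono _ _ ?_ (𝓛.α_mem_L hτ j))
    rintro _ ⟨a, ha, rfl⟩ ⟨b, hb, hab⟩
    refine hnot (Finset.mem_smul_finset.2 ⟨b * a⁻¹, Finset.mul_mem_mul hb (Finset.inv_mem_inv ha), ?_⟩)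
    simp only [smul_eq_mul] at hab ⊢
    rw [← mul_assoc, hab, mul_inv_cancel_right]

open Classical in
/-- A finite subset of the halo product, most of whose points lie in slices of size at least `m` and
are not moved outside of it by `τ`, has exponential size. -/
lemma mul_log_two_le_of_slices {P : Finset K} {τ : 𝓛.Lamp} (hτ : τ ∈ 𝓛.L (P : Set K))
    (hτ1 : τ ≠ 1) (A : Finset 𝓛.Product) (W : Finset 𝓛.Lamp) {m : ℝ}
    (hWA' : W ⊆ A.image SemidirectProduct.left)
    (hW : ∀ σ ∈ W, m ≤ (A.filter fun g => g.left = σ).card)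
    (hA : 4 * (A.filter fun g => g.left ∉ W).card +
      4 * (A.filter fun g => g * SemidirectProduct.inl τ ∉ A).card < A.card) :
    m * Real.log 2 ≤ 4 * (P * P⁻¹).card * Real.log A.card := by
  set B := A.filter fun g => g.left ∉ W with hB
  set D := A.filter fun g => g * SemidirectProduct.inl τ ∉ A with hD
  set B' := A.filter fun g => g * SemidirectProduct.inl τ ∈ B with hB'
  set Gd := A.filter fun g => g.left ∈ W ∧ (g * SemidirectProduct.inl τ).left ∈ W with hGd
  set Y := A.image SemidirectProduct.right with hY
  have hB'card : B'.card ≤ B.card :=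
    Finset.card_le_card_of_injOn (fun g => g * SemidirectProduct.inl τ)
      (fun g hg => (Finset.mem_filter.1 hg).2) fun _ _ _ _ h => mul_right_cancel h
  have hcover : A ⊆ (Gd ∪ B) ∪ (D ∪ B') := by
    intro g
    simp only [hB, hD, hB', hGd, Finset.mem_union, Finset.mem_filter]
    tauto
  have hcard : A.card ≤ (Gd.card + B.card) + (D.card + B'.card) :=
    (Finset.card_le_card hcover).trans ((Finset.card_union_le _ _).trans
      (add_le_add (Finset.card_union_le _ _) (Finset.card_union_le _ _)))
  -- Points outside `Gd` number at most `2 |B| + |D|`, which is less than half of `|A|`.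
  have hAG : A.card < 2 * Gd.card := by omega
  -- Right multiplication by `τ` sends `(σ, h)` to `(σ * α h τ, h)`, so each point of `Gd` is an
  -- edge of `W` in the direction indexed by `h`.
  have hGle : Gd.card ≤ ∑ h ∈ Y, (W.filter fun σ => σ * 𝓛.α h τ ∈ W).card := by
    rw [← Finset.card_sigma]
    refine Finset.card_le_card_of_injOn (fun g => ⟨g.right, g.left⟩) (fun g hg => ?_) ?_
    · replace hg := Finset.mem_filter.1 hg
      simp only [SemidirectProduct.mul_left, SemidirectProduct.left_inl] at hg
      simp only [Finset.coe_sigma, Set.mem_sigma_iff, Finset.mem_coe, Finset.mem_filter]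
      exact ⟨Finset.mem_image_of_mem _ hg.1, hg.2.1, hg.2.2⟩
    · intro g _ g' _ h
      simp only [Sigma.mk.injEq, heq_eq_eq] at h
      exact SemidirectProduct.ext h.2 h.1
  have hWA : ∑ σ ∈ W, (A.filter fun g => g.left = σ).card ≤ A.card := by
    rw [← Finset.card_biUnion fun σ _ σ' _ hne => Finset.disjoint_left.2 fun g hg hg' =>
      hne ((Finset.mem_filter.1 hg).2.symm.trans (Finset.mem_filter.1 hg').2)]
    exact Finset.card_le_card (Finset.biUnion_subset.2 fun σ _ => Finset.filter_subset _ _)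
  have hmW : m * W.card ≤ A.card := by
    have h1 : ∑ σ ∈ W, m ≤ ∑ σ ∈ W, ((A.filter fun g => g.left = σ).card : ℝ) :=
      Finset.sum_le_sum hW
    rw [Finset.sum_const, nsmul_eq_mul, mul_comm] at h1
    exact h1.trans (by exact_mod_cast hWA)
  have hedge := 𝓛.sum_card_lamp_edges_le hτ hτ1 Y W
  have hGle' : (Gd.card : ℝ) ≤ ∑ h ∈ Y, ((W.filter fun σ => σ * 𝓛.α h τ ∈ W).card : ℝ) := by
    exact_mod_cast hGle
  have hAG' : (A.card : ℝ) ≤ 2 * Gd.card := by exact_mod_cast hAG.le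
  have hWpos : 0 < W.card := by
    obtain ⟨g, hg⟩ : Gd.Nonempty := Finset.card_pos.1 (by omega)
    exact Finset.card_pos.2 ⟨g.left, (Finset.mem_filter.1 hg).2.1⟩
  have hWle : W.card ≤ A.card := by
    exact (Finset.card_le_card hWA').trans Finset.card_image_le
  have hWpos' : (0 : ℝ) < W.card := by exact_mod_cast hWpos
  have hlog : Real.log W.card ≤ Real.log A.card :=
    Real.log_le_log hWpos' (by exact_mod_cast hWle)
  have hl2 : 0 ≤ Real.log 2 := Real.log_nonneg (by norm_num)
  have e1 : m * W.card * Real.log 2 ≤ 4 * (P * P⁻¹).card * (W.card * Real.log W.card) := by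
    have := mul_le_mul_of_nonneg_right (hmW.trans (hAG'.trans
      (mul_le_mul_of_nonneg_left hGle' zero_le_two))) hl2
    linarith
  have e2 : m * Real.log 2 ≤ 4 * (P * P⁻¹).card * Real.log W.card := by
    refine le_of_mul_le_mul_right ?_ hWpos'
    linarith
  exact e2.trans (by gcongr)

open Classical in
-- Moves in the base keep the lamp configuration, so the gradient along them splits over the slices;
-- the generator `τ` only adds nonnegative terms.
lemma sum_gradEnergy_slice_le (S : Finset K) (τ : 𝓛.Lamp) (A : Finset 𝓛.Product)
    (Z : Finset 𝓛.Lamp) :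
    ∑ σ ∈ Z, gradEnergy S 1 ((((A.filter fun g => g.left = σ).image SemidirectProduct.right :
      Finset K) : Set K).indicator 1) ≤
    gradEnergy (S.image (SemidirectProduct.inr (φ := 𝓛.α)) ∪ {SemidirectProduct.inl τ}) 1
      ((A : Set 𝓛.Product).indicator 1) := by
  refine (ENNReal.sum_le_tsum Z).trans ?_
  conv_rhs => rw [gradEnergy, 𝓛.tsum_product]
  have ind : ∀ (σ : 𝓛.Lamp) (h : K), (((A.filter fun g => g.left = σ).image
      SemidirectProduct.right : Finset K) : Set K).indicator (1 : K → ℝ) h =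
        (A : Set 𝓛.Product).indicator 1 ⟨σ, h⟩ := fun σ h => by
    have : (h ∈ (A.filter fun g => g.left = σ).image SemidirectProduct.right) ↔
        (⟨σ, h⟩ : 𝓛.Product) ∈ A := by
      simp only [Finset.mem_image, Finset.mem_filter]
      constructor
      · rintro ⟨g, ⟨hg, rfl⟩, rfl⟩; exact hg
      · intro hg; exact ⟨_, ⟨hg, rfl⟩, rfl⟩
    simp only [Set.indicator_apply, Finset.mem_coe, this]
    rfl
  refine ENNReal.tsum_le_tsum fun σ => ?_
  rw [gradEnergy]
  refine ENNReal.tsum_le_tsum fun h => ?_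
  refine le_trans (le_of_eq ?_) (Finset.sum_le_sum_of_subset Finset.subset_union_left)
  rw [Finset.sum_image SemidirectProduct.inr_injective.injOn]
  refine Finset.sum_congr rfl fun s _ => ?_
  have : (⟨σ, h⟩ : 𝓛.Product) * SemidirectProduct.inr s = ⟨σ, h * s⟩ := by
    ext <;> simp
  rw [ind, ind, this]

lemma card_boundary_le {G : Type u} [Group G] [DecidableEq G] (U A : Finset G) {u : G} (hu : u ∈ U) :
    ((A.filter fun g => g * u ∉ A).card : ℝ≥0∞) ≤ gradEnergy U 1 ((A : Set G).indicator 1) := by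
  refine le_trans ?_ (ENNReal.sum_le_tsum (A.filter fun g => g * u ∉ A))
  rw [Finset.card_eq_sum_ones, Nat.cast_sum]
  refine Finset.sum_le_sum fun g hg => ?_
  rw [Finset.mem_filter] at hg
  refine le_trans (le_of_eq ?_) (Finset.single_le_sum (fun _ _ => zero_le) hu)
  simp [hg.1, hg.2]

open Classical in
/-- The points in small slices are controlled by the isoperimetry of the base. -/
lemma card_small_slices_le (τ : 𝓛.Lamp) (S : Finset K) {m : ℝ} {J : ℝ≥0∞}
    (isoJ : ∀ F : Finset K, (F.card : ℝ) ≤ m → (F.card : ℝ≥0∞) ≤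
      J * gradEnergy S 1 ((F : Set K).indicator 1)) (A : Finset 𝓛.Product) :
    ((A.filter fun g => g.left ∉ (A.image SemidirectProduct.left).filter fun σ =>
      m ≤ (A.filter fun g => g.left = σ).card).card : ℝ≥0∞) ≤
    J * gradEnergy (S.image (SemidirectProduct.inr (φ := 𝓛.α)) ∪ {SemidirectProduct.inl τ}) 1
      ((A : Set 𝓛.Product).indicator 1) := by
  set W := (A.image SemidirectProduct.left).filter fun σ =>
    m ≤ (A.filter fun g => g.left = σ).card with hW
  set Z := (A.image SemidirectProduct.left).filter fun σ =>
    ¬ m ≤ (A.filter fun g => g.left = σ).card with hZ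
  have hsub : (A.filter fun g => g.left ∉ W) ⊆ Z.biUnion fun σ => A.filter fun g => g.left = σ := by
    intro g hg
    rw [Finset.mem_filter] at hg
    have him := Finset.mem_image_of_mem SemidirectProduct.left hg.1
    simp only [hW, Finset.mem_filter, not_and] at hg
    exact Finset.mem_biUnion.2 ⟨g.left, Finset.mem_filter.2 ⟨him, hg.2 him⟩,
      Finset.mem_filter.2 ⟨hg.1, rfl⟩⟩
  calc ((A.filter fun g => g.left ∉ W).card : ℝ≥0∞)
      ≤ ((∑ σ ∈ Z, (A.filter fun g => g.left = σ).card : ℕ) : ℝ≥0∞) := by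
        exact_mod_cast (Finset.card_le_card hsub).trans Finset.card_biUnion_le
    _ = ∑ σ ∈ Z, ((A.filter fun g => g.left = σ).card : ℝ≥0∞) := by push_cast; rfl
    _ ≤ ∑ σ ∈ Z, J * gradEnergy S 1 ((((A.filter fun g => g.left = σ).image
          SemidirectProduct.right : Finset K) : Set K).indicator 1) := by
        refine Finset.sum_le_sum fun σ hσ => ?_
        have hinj : ((A.filter fun g => g.left = σ).image SemidirectProduct.right).card =
            (A.filter fun g => g.left = σ).card := by
          refine Finset.card_image_of_injOn fun g hg g' hg' h => ?_
          simp only [Finset.mem_coe, Finset.mem_filter] at hg hg'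
          exact SemidirectProduct.ext (hg.2.trans hg'.2.symm) h
        have := isoJ ((A.filter fun g => g.left = σ).image SemidirectProduct.right)
          (by rw [hinj]; exact (not_le.1 (Finset.mem_filter.1 hσ).2).le)
        rwa [hinj] at this
    _ ≤ _ := by
        rw [← Finset.mul_sum]
        gcongr
        exact 𝓛.sum_gradEnergy_slice_le S τ A Z

open Classical in
/-- The isoperimetric inequality for finite subsets of the halo product. -/
lemma card_le_mul_gradEnergy {P : Finset K} {τ : 𝓛.Lamp} (hτ : τ ∈ 𝓛.L (P : Set K))
    (hτ1 : τ ≠ 1) (S : Finset K) {m : ℝ} (hm : 1 ≤ m) (hJ : isoProfile S 1 m ≠ ⊤)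
    (A : Finset 𝓛.Product) (hA : 4 * (P * P⁻¹).card * Real.log A.card < m * Real.log 2) :
    (A.card : ℝ≥0∞) ≤ (4 + 8 * S.card) * isoProfile S 1 m *
      gradEnergy (S.image (SemidirectProduct.inr (φ := 𝓛.α)) ∪ {SemidirectProduct.inl τ}) 1
        ((A : Set 𝓛.Product).indicator 1) := by
  set J := isoProfile S 1 m with hJdef
  set U := S.image (SemidirectProduct.inr (φ := 𝓛.α)) ∪ {SemidirectProduct.inl τ}
  set E := gradEnergy U 1 ((A : Set 𝓛.Product).indicator 1) with hE
  have isoJ : ∀ F : Finset K, (F.card : ℝ) ≤ m → (F.card : ℝ≥0∞) ≤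
      J * gradEnergy S 1 ((F : Set K).indicator 1) := fun F hF => by
    have hfin : gradEnergy S 1 ((F : Set K).indicator 1) ≠ ⊤ := by
      refine ne_top_of_le_ne_top ?_ (gradEnergy_one_le S _)
      rw [tsum_enorm_indicator]
      exact ENNReal.mul_ne_top (ENNReal.mul_ne_top (by simp) (by simp)) (by simp)
    exact (ENNReal.div_le_iff_le_mul (Or.inr hJ) (Or.inl hfin)).1 (ratio_indicator_le S F hF)
  -- Testing on a singleton bounds `J` from below, so the boundary term `4 * E` is absorbed into `8
  -- * |S| * J * E`.
  have hJ1 : 1 ≤ J * (2 * S.card) := by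
    have h1 := isoJ {1} (by simpa using hm)
    have h2 := gradEnergy_one_le S ((({1} : Finset K) : Set K).indicator 1)
    rw [tsum_enorm_indicator, Finset.card_singleton, Nat.cast_one, mul_one] at h2
    rw [Finset.card_singleton, Nat.cast_one] at h1
    exact h1.trans (by gcongr)
  by_contra! hcon
  set W := (A.image SemidirectProduct.left).filter fun σ =>
    m ≤ (A.filter fun g => g.left = σ).card with hW
  refine absurd (𝓛.mul_log_two_le_of_slices hτ hτ1 A W (Finset.filter_subset _ _)
    (fun σ hσ => (Finset.mem_filter.1 hσ).2) ?_) (not_le.2 hA)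
  have hB : ((A.filter fun g => g.left ∉ W).card : ℝ≥0∞) ≤ J * E :=
    𝓛.card_small_slices_le τ S isoJ A
  have hD : ((A.filter fun g => g * SemidirectProduct.inl τ ∉ A).card : ℝ≥0∞) ≤ E :=
    card_boundary_le U A (by simp [U])
  have hfinal : ((4 * (A.filter fun g => g.left ∉ W).card +
      4 * (A.filter fun g => g * SemidirectProduct.inl τ ∉ A).card : ℕ) : ℝ≥0∞) < A.card := by
    refine lt_of_le_of_lt ?_ hcon
    push_cast
    calc _ ≤ 4 * (J * E) + 4 * (1 * E) := by rw [one_mul]; gcongr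
      _ ≤ 4 * (J * E) + 4 * (J * (2 * S.card) * E) := by gcongr
      _ = _ := by ring
  exact_mod_cast hfinal

open Classical in
/-- The `ℓ^1`-profile of a halo product is at most the profile of the base evaluated at the
logarithm. -/
lemma exists_isoProfile_product_le [Nontrivial 𝓛.Lamp] (S : Finset K) {T : Finset 𝓛.Product}
    (hT : IsGeneratingSet T) : ∃ C : ℝ, 1 ≤ C ∧ ∀ᶠ x : ℝ in atTop,
      isoProfile T 1 x ≤ ENNReal.ofReal C * isoProfile S 1 (C * Real.log x) := by
  obtain ⟨P, τ, hτ, hτ1⟩ := 𝓛.exists_mem_L_ne_one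
  obtain ⟨C₀, hC₀, hT'⟩ := exists_isoProfile_le hT
    (S.image (SemidirectProduct.inr (φ := 𝓛.α)) ∪ {SemidirectProduct.inl τ}) le_rfl
  set N : ℝ := (((P * P⁻¹).card : ℕ) : ℝ) with hN
  have hN0 : 0 ≤ N := Nat.cast_nonneg _
  have hl2 : 0 < Real.log 2 := Real.log_pos (by norm_num)
  set C₁ : ℝ := C₀ * (4 + 8 * S.card) with hC₁
  -- The extra `1` in `4 * N + 1` makes the size condition on `A` strict, as `log x > 0`.
  set C : ℝ := max C₁ ((4 * N + 1) / Real.log 2) with hC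
  have hC1 : 1 ≤ C₁ := by
    have : (0 : ℝ) ≤ S.card := Nat.cast_nonneg _
    nlinarith
  have hCC : 1 ≤ C := hC1.trans (le_max_left _ _)
  refine ⟨C, hCC, ?_⟩
  filter_upwards [Real.tendsto_log_atTop.eventually_ge_atTop 1, eventually_ge_atTop 1] with x hx hx1
  rcases eq_or_ne (isoProfile S 1 (C * Real.log x)) ⊤ with hJ | hJ
  · rw [hJ, ENNReal.mul_top (by simp; linarith)]
    exact le_top
  have hm : 1 ≤ C * Real.log x := by nlinarith
  calc isoProfile T 1 x ≤ ENNReal.ofReal C₀ * _ := hT' x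
    _ ≤ ENNReal.ofReal C₀ * ((4 + 8 * S.card) * isoProfile S 1 (C * Real.log x)) := by
        refine mul_le_mul_right (isoProfile_one_le_of_indicator _ fun A hA => ?_) _
        rcases A.eq_empty_or_nonempty with rfl | hne
        · simp
        refine 𝓛.card_le_mul_gradEnergy hτ hτ1 S hm hJ A ?_
        have hlog : Real.log A.card ≤ Real.log x :=
          Real.log_le_log (by exact_mod_cast Finset.card_pos.2 hne) hA
        have hCN : 4 * N + 1 ≤ C * Real.log 2 := (div_le_iff₀ hl2).1 (le_max_right _ _)
        rw [← hN]
        calc 4 * N * Real.log A.card ≤ 4 * N * Real.log x := by gcongr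
          _ < (4 * N + 1) * Real.log x := by linarith
          _ ≤ C * Real.log 2 * Real.log x := by gcongr
          _ = _ := by ring
    _ = ENNReal.ofReal C₁ * isoProfile S 1 (C * Real.log x) := by
        rw [hC₁, ENNReal.ofReal_mul (by linarith), ENNReal.ofReal_add (by norm_num) (by positivity),
          ENNReal.ofReal_mul (by norm_num)]
        simp [mul_assoc]
    _ ≤ _ := by gcongr; exact le_max_left _ _

end EquivariantHalo

/-! ### Iterated logarithms at infinity -/

section IteratedLogarithm

lemma tendsto_iterate_log_atTop (n : ℕ) : Tendsto (fun x => Real.log^[n] x) atTop atTop := by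
  induction n with
  | zero => exact tendsto_id
  | succ n ih => exact ih.comp Real.tendsto_log_atTop

/-- `Real.log` is not monotone on the whole line, so its iterates can be compared only beyond a
threshold. -/
lemma eventually_iterate_log_mono (n : ℕ) :
    ∀ᶠ x : ℝ in atTop, ∀ y, x ≤ y → Real.log^[n] x ≤ Real.log^[n] y := by
  induction n with
  | zero => exact .of_forall fun _ _ h => h
  | succ n ih =>
    filter_upwards [Real.tendsto_log_atTop.eventually ih, eventually_gt_atTop 0] with x hx h0 y hy
    exact hx _ (Real.log_le_log h0 hy)

/-- The case of one logarithm is `log C + log x ≤ C * log x` for large `x`, which requires `C > 1`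
strictly. -/
lemma eventually_iterate_log_mul_le {C : ℝ} (hC : 1 < C) (n : ℕ) :
    ∀ᶠ x : ℝ in atTop, Real.log^[n] (C * x) ≤ C * Real.log^[n] x := by
  induction n with
  | zero => exact .of_forall fun _ => le_rfl
  | succ n ih =>
    have hC0 : 0 < C := by linarith
    have hlog : Tendsto (fun x => Real.log (C * x)) atTop atTop :=
      Real.tendsto_log_atTop.comp (tendsto_id.const_mul_atTop hC0)
    filter_upwards [Real.tendsto_log_atTop.eventually ih,
      hlog.eventually (eventually_iterate_log_mono n),
      Real.tendsto_log_atTop.eventually_ge_atTop (Real.log C / (C - 1)),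
      eventually_gt_atTop 0] with x h1 h2 h3 h0
    refine (h2 _ ?_).trans h1
    rw [div_le_iff₀ (by linarith)] at h3
    rw [Real.log_mul hC0.ne' h0.ne']
    linarith

end IteratedLogarithm

/-! ### Induction along the tower -/

section Iteration

variable {H : Type u} [Group H] (𝓛 : ∀ (K : Type u) [Group K], EquivariantHalo K)

lemma infinite_iteratedHaloProduct [Infinite H] (n : ℕ) :
    Infinite (iteratedHaloProduct 𝓛 H n) := by
  induction n with
  | zero => exact ‹Infinite H›
  | succ n ih =>
    exact Infinite.of_injective
      (SemidirectProduct.inr (φ := (𝓛 (iteratedHaloProduct 𝓛 H n)).α))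
      SemidirectProduct.inr_injective

lemma exists_isoProfile_iterate_psi_le [Infinite H] {p : ℝ} (hp : 1 ≤ p) {S : Finset H}
    (hS : IsGeneratingSet S) (n : ℕ)
    (hnat : ∀ k < n, (𝓛 (iteratedHaloProduct 𝓛 H k)).NaturallyGenerated)
    (hcons : ∀ k < n, (𝓛 (iteratedHaloProduct 𝓛 H k)).ConsistentBlocks)
    (hgrowth : ∀ k < n, (𝓛 (iteratedHaloProduct 𝓛 H k)).lampGrowth = (𝓛 H).lampGrowth)
    (T : Finset (iteratedHaloProduct 𝓛 H n)) :
    ∃ C : ℝ, 1 ≤ C ∧ ∀ x : ℝ, isoProfile S p ((psi (𝓛 H).lampGrowth C)^[n] x) ≤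
      ENNReal.ofReal C * isoProfile T p x := by
  induction n with
  | zero => exact exists_isoProfile_le hS T hp
  | succ n ih =>
    have hlt : n < n + 1 := Nat.lt_succ_self n
    have := infinite_iteratedHaloProduct (H := H) 𝓛 n
    have hc := hcons n hlt
    obtain ⟨R, -, hR⟩ := hnat n hlt
    obtain ⟨V, hV, hgen⟩ := EquivariantHalo.exists_finset_generators _ hc hR
    obtain ⟨C₀, hC₀, h₀⟩ := ih (fun k hk => hnat k (by omega)) (fun k hk => hcons k (by omega))
      (fun k hk => hgrowth k (by omega)) R
    obtain ⟨C₁, hC₁, h₁⟩ := exists_isoProfile_le hgen T hp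
    have hone : ∀ m, 1 ≤ (𝓛 H).lampGrowth m := by
      rw [← hgrowth n hlt]
      exact EquivariantHalo.one_le_lampGrowth _ hc
    set C₂ : ℝ := 2 + (R.card : ℝ) with hC₂
    have hC₂0 : 2 ≤ C₂ := by simp [hC₂]
    set C : ℝ := max C₂ (C₀ * C₁) with hC
    have hC₀C : C₀ ≤ C := le_trans (by nlinarith) (le_max_right _ _)
    have hC₂C : C₂ ≤ C := le_max_left _ _
    refine ⟨C, by linarith, fun x => ?_⟩
    -- The iterate `f^[n + 1] x` unfolds to `f^[n] (f x)`: the inner `psi` accounts for the top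
    -- floor, the outer ones for the floors below.
    calc isoProfile S p ((psi (𝓛 H).lampGrowth C)^[n] (psi (𝓛 H).lampGrowth C x))
        ≤ isoProfile S p ((psi (𝓛 H).lampGrowth C₀)^[n] (psi (𝓛 H).lampGrowth C x)) :=
          isoProfile_mono (iterate_psi_anti hone (by linarith) hC₀C n _)
      _ ≤ ENNReal.ofReal C₀ * isoProfile R p (psi (𝓛 H).lampGrowth C x) := h₀ _
      _ ≤ ENNReal.ofReal C₀ * isoProfile R p (psi (𝓛 H).lampGrowth C₂ x) := by
          gcongr
          exact isoProfile_mono (psi_anti (by linarith) hC₂C x)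
      _ ≤ ENNReal.ofReal C₀ * (ENNReal.ofReal C₁ * isoProfile T p x) := by
          gcongr
          refine le_trans ?_ (h₁ x)
          rw [← hgrowth n hlt]
          exact EquivariantHalo.isoProfile_le_isoProfile_product _ hc hV hp (by linarith) x
      _ = ENNReal.ofReal (C₀ * C₁) * isoProfile T p x := by
          rw [ENNReal.ofReal_mul (by linarith), mul_assoc]
      _ ≤ _ := by gcongr; exact le_max_right _ _

lemma exists_isoProfile_le_iterate_log [Nontrivial (𝓛 H).Lamp] (S : Finset H)
    (n : ℕ)
    (hnat : ∀ k < n, (𝓛 (iteratedHaloProduct 𝓛 H k)).NaturallyGenerated)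
    (hcons : ∀ k < n, (𝓛 (iteratedHaloProduct 𝓛 H k)).ConsistentBlocks)
    (hgrowth : ∀ k < n, (𝓛 (iteratedHaloProduct 𝓛 H k)).lampGrowth = (𝓛 H).lampGrowth)
    (T : Finset (iteratedHaloProduct 𝓛 H n)) (hT : IsGeneratingSet T) :
    ∃ C : ℝ, 1 < C ∧ ∀ᶠ x : ℝ in atTop,
      isoProfile T 1 x ≤ ENNReal.ofReal C * isoProfile S 1 (C * Real.log^[n] x) := by
  induction n with
  | zero =>
    obtain ⟨C, hC, h⟩ := exists_isoProfile_le (G := H) (S := T) hT S le_rfl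
    refine ⟨C + 1, by linarith, ?_⟩
    filter_upwards [eventually_ge_atTop 0] with x hx
    refine (h x).trans (mul_le_mul' (ENNReal.ofReal_le_ofReal (by linarith)) ?_)
    refine isoProfile_mono ?_
    change x ≤ (C + 1) * x
    nlinarith
  | succ n ih =>
    have hlt : n < n + 1 := Nat.lt_succ_self n
    obtain ⟨R, hR, -⟩ := hnat n hlt
    have : Nontrivial (𝓛 (iteratedHaloProduct 𝓛 H n)).Lamp := by
      obtain ⟨m, hm⟩ := EquivariantHalo.exists_one_lt_lampGrowth (𝓛 H) (hcons 0 (by omega))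
      rw [← hgrowth n hlt] at hm
      exact EquivariantHalo.nontrivial_lamp_of_lampGrowth _ hm
    obtain ⟨C₀, hC₀, h₀⟩ := ih (fun k hk => hnat k (by omega)) (fun k hk => hcons k (by omega))
      (fun k hk => hgrowth k (by omega)) R hR
    obtain ⟨C₁, hC₁, h₁⟩ := EquivariantHalo.exists_isoProfile_product_le _ R hT
    -- Enlarging `C₁` meets the strict inequality required to pull the constant out of the iterated
    -- logarithm.
    have hC₂ : 1 < C₁ + 1 := by linarith
    have hmul : Tendsto (fun x => (C₁ + 1) * Real.log x) atTop atTop :=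
      Real.tendsto_log_atTop.const_mul_atTop (by linarith)
    refine ⟨C₀ * (C₁ + 1), by nlinarith, ?_⟩
    filter_upwards [h₁, hmul.eventually h₀, Real.tendsto_log_atTop.eventually_ge_atTop 0,
      Real.tendsto_log_atTop.eventually (eventually_iterate_log_mul_le hC₂ n)] with x e₁ e₀ hx e₂
    calc isoProfile T 1 x
        ≤ ENNReal.ofReal C₁ * isoProfile R 1 (C₁ * Real.log x) := e₁
      _ ≤ ENNReal.ofReal (C₁ + 1) * isoProfile R 1 ((C₁ + 1) * Real.log x) := by
          refine mul_le_mul' (ENNReal.ofReal_le_ofReal (by linarith)) (isoProfile_mono ?_)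
          nlinarith
      _ ≤ ENNReal.ofReal (C₁ + 1) * (ENNReal.ofReal C₀ *
            isoProfile S 1 (C₀ * Real.log^[n] ((C₁ + 1) * Real.log x))) := by gcongr
      _ ≤ ENNReal.ofReal (C₁ + 1) * (ENNReal.ofReal C₀ *
            isoProfile S 1 (C₀ * (C₁ + 1) * Real.log^[n] (Real.log x))) := by
          gcongr
          refine isoProfile_mono ?_
          rw [mul_assoc]
          gcongr
      _ = _ := by
          rw [ENNReal.ofReal_mul (by linarith), ← mul_assoc,
            mul_comm (ENNReal.ofReal (C₁ + 1))]
          rfl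

end Iteration

theorem mainTheorem10 (H : Type u) [Group H] [Infinite H] [Group.FG H] (hH : AmenableGroup H)
    (𝓛 : ∀ (K : Type u) [Group K], EquivariantHalo K) [Nontrivial (𝓛 H).Lamp]
    (p : ℝ) (hp : 1 ≤ p) (n : ℕ)
    (hnat : ∀ k < n, (𝓛 (iteratedHaloProduct 𝓛 H k)).NaturallyGenerated)
    (hcomm : ∀ k < n, (𝓛 (iteratedHaloProduct 𝓛 H k)).LargeScaleCommutative)
    (hcons : ∀ k < n, (𝓛 (iteratedHaloProduct 𝓛 H k)).ConsistentBlocks)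
    (hgrowth : ∀ k < n, (𝓛 (iteratedHaloProduct 𝓛 H k)).lampGrowth = (𝓛 H).lampGrowth)
    (S : Finset H) (hS : IsGeneratingSet S)
    (T : Finset (iteratedHaloProduct 𝓛 H n)) (hT : IsGeneratingSet T) :
    ∃ C : ℝ, 0 < C ∧ ∀ᶠ x : ℝ in atTop,
      ENNReal.ofReal (1 / C) * isoProfile S p ((psi (𝓛 H).lampGrowth C)^[n] x) ≤
          isoProfile T p x ∧
        isoProfile T p x ≤
          ENNReal.ofReal C * isoProfile S 1 (C * Real.log^[n] x) := by
  obtain ⟨A, hA, hlow⟩ := exists_isoProfile_iterate_psi_le 𝓛 hp hS n hnat hcons hgrowth T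
  obtain ⟨B, hB, hup⟩ := exists_isoProfile_le_iterate_log 𝓛 S n hnat hcons hgrowth T hT
  obtain ⟨D, hD, hpow⟩ := exists_isoProfile_le_isoProfile_one T hp
  -- The bound `1 ≤ Λ` comes from consistent blocks, assumed only for floors below `n`; for `n = 0`
  -- nothing is iterated.
  have hanti : ∀ C, A ≤ C → ∀ x, (psi (𝓛 H).lampGrowth C)^[n] x ≤
      (psi (𝓛 H).lampGrowth A)^[n] x := fun C hC x => by
    cases n with
    | zero => exact le_rfl
    | succ n =>
      exact iterate_psi_anti (EquivariantHalo.one_le_lampGrowth (𝓛 H) (hcons 0 (by omega)))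
        (by linarith) hC _ x
  -- The passage from `p` to `1` is made once, at the top of the tower, at the cost of the factor
  -- `D`.
  set C : ℝ := max A (D * B) with hCdef
  have hAC : A ≤ C := le_max_left _ _
  have hDBC : D * B ≤ C := le_max_right _ _
  have hC : 0 < C := by linarith
  refine ⟨C, hC, ?_⟩
  filter_upwards [hup, (tendsto_iterate_log_atTop n).eventually_ge_atTop 0] with x hx hlog
  constructor
  · calc ENNReal.ofReal (1 / C) * isoProfile S p ((psi (𝓛 H).lampGrowth C)^[n] x)
        ≤ ENNReal.ofReal (1 / C) * (ENNReal.ofReal C * isoProfile T p x) := by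
          refine mul_le_mul_right ?_ _
          refine (isoProfile_mono (hanti C hAC x)).trans ((hlow x).trans ?_)
          gcongr
      _ = isoProfile T p x := by
          rw [← mul_assoc, ← ENNReal.ofReal_mul (by positivity), one_div_mul_cancel hC.ne',
            ENNReal.ofReal_one, one_mul]
  · calc isoProfile T p x ≤ ENNReal.ofReal D * isoProfile T 1 x := hpow x
      _ ≤ ENNReal.ofReal D * (ENNReal.ofReal B * isoProfile S 1 (B * Real.log^[n] x)) := by gcongr
      _ = ENNReal.ofReal (D * B) * isoProfile S 1 (B * Real.log^[n] x) := by
          rw [ENNReal.ofReal_mul (by linarith), mul_assoc]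
      _ ≤ ENNReal.ofReal C * isoProfile S 1 (C * Real.log^[n] x) := by
          refine mul_le_mul' (ENNReal.ofReal_le_ofReal hDBC) (isoProfile_mono ?_)
          have : B ≤ C := le_trans (by nlinarith) hDBC
          gcongr
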